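/- **Model.** The typical LoRa receiver is at the origin of $\mathbb R^2$; the other LoRa receivers form a homogeneous Poisson point process $\Phi_G$ of density $\lambda_G\ge 0$. The active LoRa nodes form a Matérn cluster process: the nodes served by a receiver are independent and uniformly distributed on the disc of radius $a>0$ about it. The non-LoRa nodes form a homogeneous Poisson point process $\Phi_{\rm co}$ of density $\lambda_{\rm co}\ge 0$. The typical LoRa node $x_0$ is an unordered (arbitrary) node of the cluster of the origin, hence uniformly distributed on the disc of radius $a$ about the origin. A node at $x$ with transmit power $p$ and fading coefficient $h$ is received at the origin with power $p\,h\,\eta\,\|x\|^{-\alpha}$, where $\eta>0$ and $\alpha>2$; the transmit powers are $P_{x_0}>0$ for the typical node, $P_x>0$ for all other LoRa nodes, $P_z>0$ for the non-LoRa nodes. All fading coefficients are exponentially distributed with mean $1$, and fading coefficients, positions, numbers of nodes and the two Poisson processes are mutually independent. Let $I_{\rm intra}$, $I_{\rm inter}$, $I_{\rm co}$ be the total powers received from the other nodes of the typical cluster, from the nodes of all other clusters, and from the non-LoRa nodes, and let $\sigma^2\ge0$ be the noise power. For a threshold $\gamma_{th}>0$ the coverage probability is $$P_{\rm cov}(\gamma_{th})=\Pr\Big\{\frac{P_{x_0}h_{x_0}\eta\|x_0\|^{-\alpha}}{I_{\rm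 intra}+I_{\rm inter}+I_{\rm co}+\sigma^2}\ge\gamma_{th}\Big\}.$$ Two models for the numbers of active nodes are considered. *Fixed:* every cluster has exactly $n\ge1$ active nodes (so $n-1$ nodes share the typical cluster with the typical node). *Random:* the number of active nodes in each non-typical cluster is Poisson distributed with mean $\bar n$, where $\bar n\ge 1$ is real, and the number of nodes that share the typical cluster with the typical node is Poisson distributed with mean $\bar n-1$. Put $\delta=2/\alpha$, $\rho=\rho(r)=\dfrac{r^\alpha\gamma_{th}}{P_{x_0}\eta}$, and, with the Gauss hypergeometric function ${}_2F_1$ and $B(x,y)=\int_0^\infty t^{x-1}(1+t)^{-x-y}\,dt$, $$\mathcal L_{I^n_{\rm intra}}(s)=\Big[\frac{a^\alpha\delta}{sP_x\eta(\delta+1)}\,{}_2F_1\Big(1,\delta+1;\delta+2;-\frac{a^\alpha}{sP_x\eta}\Big)\Big]^{n-1},$$ $$\mathcal L_{I^{\bar n}_{\rm intra}}(s)=\exp\Big(-(\bar n-1)\,{}_2F_1\Big(1,\delta;\delta+1;-\frac{a^\alpha}{sP_x\eta}\Big)\Big),$$ $$\mathcal L^{up}_{I^n_{\rm inter}}(s)=\exp\Big(-\pi\lambda_G(sP_x\eta)^\delta\,\delta\sum_{p=1}^n\binom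 np B(p-\delta,n-p+\delta)\Big),$$ $$\mathcal L^{low}_{I^{\bar n}_{\rm inter}}(s)=\exp\Big(-\pi^2\lambda_G\bar n(sP_x\eta)^\delta\frac{\delta}{\sin(\pi\delta)}\Big),$$ $$\mathcal L_{I_{\rm co}}(s)=\exp\big(-\pi\lambda_{\rm co}\Gamma(1+\delta)\Gamma(1-\delta)(sP_z\eta)^\delta\big).$$ **Theorem 1.** In the fixed model, for every $n\ge1$, $$P_{\rm cov}(\gamma_{th})\le\frac2{a^2}\int_0^a e^{-\rho\sigma^2}\,\mathcal L_{I^n_{\rm intra}}(\rho)\,\mathcal L^{up}_{I^n_{\rm inter}}(\rho)\,\mathcal L_{I_{\rm co}}(\rho)\,r\,dr .$$ In the random model, for every real $\bar n\ge1$, $$P_{\rm cov}(\gamma_{th})\ge\frac2{a^2}\int_0^a e^{-\rho\sigma^2}\,\mathcal L_{I^{\bar n}_{\rm intra}}(\rho)\,\mathcal L^{low}_{I^{\bar n}_{\rm inter}}(\rho)\,\mathcal L_{I_{\rm co}}(\rho)\,r\,dr .$$ Both integrals converge. -/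

import Mathlib

open MeasureTheory ProbabilityTheory
open scoped NNReal ENNReal

namespace LoRa

noncomputable section

/-! ## Point processes -/

/-- The Euclidean plane. -/
abbrev Plane : Type := EuclideanSpace ℝ (Fin 2)

/-- A point process on the plane, given by an enumeration of its (finitely or infinitely many)
points: in the outcome `ω`, the points are `point i ω` for the indices `i < count ω`. -/
structure PointProcess (Ω : Type*) where
  /-- the total number of points -/
  count : Ω → ℕ∞
  /-- the location of the `i`-th point (meaningful if `i < count ω`) -/
  point : ℕ → Ω → Plane

namespace PointProcess

variable {Ω : Type*} (Φ : PointProcess Ω)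

/-- The sum of `f i` over the indices `i` of the points of the process that are present in the
outcome `ω`. -/
def sumPoints (f : ℕ → ℝ≥0∞) (ω : Ω) : ℝ≥0∞ :=
  open scoped Classical in ∑' i : ℕ, if (i : ℕ∞) < Φ.count ω then f i else 0

/-- The number of points of the process in the set `B`. -/
def numIn (B : Set Plane) (ω : Ω) : ℝ≥0∞ :=
  Φ.sumPoints (fun i => B.indicator 1 (Φ.point i ω)) ω

/-- The σ-algebra generated by the process. -/
@[reducible] def sigma : MeasurableSpace Ω :=
  MeasurableSpace.comap Φ.count inferInstance ⊔
    ⨆ i, MeasurableSpace.comap (Φ.point i) inferInstance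

/-- `Φ` is a homogeneous Poisson point process of density `dens` on the plane: the number of
points in a Borel set `B` of finite area is Poisson distributed with mean `dens * area B`, and the
numbers of points in pairwise disjoint Borel sets of finite area are independent. -/
structure IsPoisson [MeasurableSpace Ω] (P : Measure Ω) (dens : ℝ≥0) : Prop where
  measurable_count : Measurable Φ.count
  measurable_point : ∀ i, Measurable (Φ.point i)
  hasLaw_numIn : ∀ B : Set Plane, MeasurableSet B → volume B ≠ ⊤ →
    HasLaw (Φ.numIn B)
      ((poissonMeasure (dens * (volume B).toNNReal)).map (Nat.cast : ℕ → ℝ≥0∞)) P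
  indep_numIn : ∀ (m : ℕ) (B : Fin m → Set Plane), (∀ k, MeasurableSet (B k)) →
    (∀ k, volume (B k) ≠ ⊤) → Pairwise (fun k l => Disjoint (B k) (B l)) →
    iIndepFun (fun k => Φ.numIn (B k)) P

end PointProcess

/-! ## The network -/

/-- The law of a point that is uniformly distributed on the disc of radius `r` about the origin. -/
def uniformDisc (r : ℝ) : Measure Plane :=
  ProbabilityTheory.cond volume (Metric.closedBall (0 : Plane) r)

/-- The parameters of the network. -/
structure Params where
  /-- cluster radius -/
  a : ℝ
  /-- path loss exponent -/
  α : ℝ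
  /-- frequency dependent factor of the path loss -/
  η : ℝ
  /-- transmit power of the typical LoRa node -/
  Px₀ : ℝ
  /-- transmit power of the interfering LoRa nodes -/
  Px : ℝ
  /-- transmit power of the non-LoRa nodes -/
  Pz : ℝ
  /-- `σ ^ 2` is the noise power -/
  σ : ℝ
  /-- density of the LoRa receivers -/
  densG : ℝ≥0
  /-- density of the non-LoRa nodes -/
  densCo : ℝ≥0
  a_pos : 0 < a
  two_lt_α : 2 < α
  η_pos : 0 < η
  Px₀_pos : 0 < Px₀
  Px_pos : 0 < Px
  Pz_pos : 0 < Pz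

/-- The random quantities of the network, seen from the typical LoRa receiver, which is placed at
the origin. -/
structure Network (Ω : Type*) where
  /-- location of the typical LoRa node -/
  x₀ : Ω → Plane
  /-- fading coefficient of the typical LoRa node -/
  h₀ : Ω → ℝ
  /-- number of the other active LoRa nodes in the typical cluster -/
  numIntra : Ω → ℕ
  /-- location of the `j`-th other node of the typical cluster (present if `j < numIntra ω`) -/
  xIntra : ℕ → Ω → Plane
  /-- fading coefficient of that node -/
  hIntra : ℕ → Ω → ℝ
  /-- the LoRa receivers other than the typical one -/
  receivers : PointProcess Ω
  /-- number of active LoRa nodes in the cluster of the `i`-th other receiver -/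
  numInter : ℕ → Ω → ℕ
  /-- displacement from the `i`-th other receiver to the `j`-th node of its cluster (present if
  `j < numInter i ω`) -/
  xInter : ℕ → ℕ → Ω → Plane
  /-- fading coefficient (towards the typical receiver) of that node -/
  hInter : ℕ → ℕ → Ω → ℝ
  /-- the non-LoRa nodes -/
  nonLoRa : PointProcess Ω
  /-- fading coefficient of the `i`-th non-LoRa node -/
  hCo : ℕ → Ω → ℝ

/-- Labels of the independent sources of randomness of the network. -/
inductive Source where
  | x₀ | h₀ | numIntra
  | xIntra (j : ℕ) | hIntra (j : ℕ)
  | receivers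
  | numInter (i : ℕ) | xInter (i j : ℕ) | hInter (i j : ℕ)
  | nonLoRa
  | hCo (i : ℕ)

/-- The large-scale fading coefficient times transmit power times small-scale fading coefficient:
the power `p h η ‖x‖ ^ (-α)` received at the origin from a node at `x` that transmits with power
`p` and has fading coefficient `h`. -/
def Params.receivedPower (S : Params) (p h : ℝ) (x : Plane) : ℝ≥0∞ :=
  ENNReal.ofReal (p * h * S.η) * ‖x‖ₑ ^ (-S.α)

namespace Network

variable {Ω : Type*} (X : Network Ω)

/-- The σ-algebra generated by each source of randomness. -/
@[reducible] def sigma : Source → MeasurableSpace Ω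
  | .x₀ => MeasurableSpace.comap X.x₀ inferInstance
  | .h₀ => MeasurableSpace.comap X.h₀ inferInstance
  | .numIntra => MeasurableSpace.comap X.numIntra inferInstance
  | .xIntra j => MeasurableSpace.comap (X.xIntra j) inferInstance
  | .hIntra j => MeasurableSpace.comap (X.hIntra j) inferInstance
  | .receivers => X.receivers.sigma
  | .numInter i => MeasurableSpace.comap (X.numInter i) inferInstance
  | .xInter i j => MeasurableSpace.comap (X.xInter i j) inferInstance
  | .hInter i j => MeasurableSpace.comap (X.hInter i j) inferInstance
  | .nonLoRa => X.nonLoRa.sigma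
  | .hCo i => MeasurableSpace.comap (X.hCo i) inferInstance

/-- `X` is a network with parameters `S` in which the LoRa nodes form a Matérn cluster process:
the LoRa receivers form a Poisson point process, the nodes of each cluster are uniformly
distributed on the disc of radius `a` about their receiver, the non-LoRa nodes form a Poisson point
process, all fading coefficients are exponentially distributed with mean `1`, and all these random
quantities are independent. The law of the number of active nodes of a cluster is `ν`; the law of
the number of nodes that share the typical cluster with the typical node is `ν₀`. -/
structure IsMatern [MeasurableSpace Ω] (P : Measure Ω) (S : Params) (ν₀ ν : Measure ℕ) :
    Prop where
  measurable_x₀ : Measurable X.x₀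
  measurable_h₀ : Measurable X.h₀
  measurable_numIntra : Measurable X.numIntra
  measurable_xIntra : ∀ j, Measurable (X.xIntra j)
  measurable_hIntra : ∀ j, Measurable (X.hIntra j)
  measurable_numInter : ∀ i, Measurable (X.numInter i)
  measurable_xInter : ∀ i j, Measurable (X.xInter i j)
  measurable_hInter : ∀ i j, Measurable (X.hInter i j)
  measurable_hCo : ∀ i, Measurable (X.hCo i)
  law_x₀ : HasLaw X.x₀ (uniformDisc S.a) P
  law_h₀ : HasLaw X.h₀ (expMeasure 1) P
  law_numIntra : HasLaw X.numIntra ν₀ P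
  law_xIntra : ∀ j, HasLaw (X.xIntra j) (uniformDisc S.a) P
  law_hIntra : ∀ j, HasLaw (X.hIntra j) (expMeasure 1) P
  receivers_poisson : X.receivers.IsPoisson P S.densG
  law_numInter : ∀ i, HasLaw (X.numInter i) ν P
  law_xInter : ∀ i j, HasLaw (X.xInter i j) (uniformDisc S.a) P
  law_hInter : ∀ i j, HasLaw (X.hInter i j) (expMeasure 1) P
  nonLoRa_poisson : X.nonLoRa.IsPoisson P S.densCo
  law_hCo : ∀ i, HasLaw (X.hCo i) (expMeasure 1) P
  indep : iIndep X.sigma P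

/-- Matérn cluster network in which every cluster, the typical one included, has exactly `n` active
nodes. -/
def IsMaternFixed [MeasurableSpace Ω] (P : Measure Ω) (S : Params) (n : ℕ) : Prop :=
  X.IsMatern P S (Measure.dirac (n - 1)) (Measure.dirac n)

/-- Matérn cluster network in which the number of active nodes of a cluster is Poisson distributed
with mean `nbar`, and the number of nodes that interfere with the typical node from within its own
cluster is Poisson distributed with mean `nbar - 1` (so that the mean number of active nodes is
`nbar` in the typical cluster, too). Used for `1 ≤ nbar` only. -/
def IsMaternPoisson [MeasurableSpace Ω] (P : Measure Ω) (S : Params) (nbar : ℝ≥0) : Prop :=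
  X.IsMatern P S (poissonMeasure (nbar - 1)) (poissonMeasure nbar)

variable (S : Params)

/-- Intra-cluster interference. -/
def Iintra (ω : Ω) : ℝ≥0∞ :=
  ∑ j ∈ Finset.range (X.numIntra ω), S.receivedPower S.Px (X.hIntra j ω) (X.xIntra j ω)

/-- Inter-cluster interference. -/
def Iinter (ω : Ω) : ℝ≥0∞ :=
  X.receivers.sumPoints (fun i => ∑ j ∈ Finset.range (X.numInter i ω),
    S.receivedPower S.Px (X.hInter i j ω) (X.receivers.point i ω + X.xInter i j ω)) ω

/-- Coexistence interference. -/
def Ico (ω : Ω) : ℝ≥0∞ :=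
  X.nonLoRa.sumPoints (fun i => S.receivedPower S.Pz (X.hCo i ω) (X.nonLoRa.point i ω)) ω

/-- The signal-to-interference-plus-noise ratio of the typical node at its receiver. -/
def sinr (ω : Ω) : ℝ≥0∞ :=
  S.receivedPower S.Px₀ (X.h₀ ω) (X.x₀ ω) /
    (X.Iintra S ω + X.Iinter S ω + X.Ico S ω + ENNReal.ofReal (S.σ ^ 2))

/-- The coverage probability of the typical node for the SINR threshold `γ`. -/
def coverageProb [MeasurableSpace Ω] (P : Measure Ω) (γ : ℝ) : ℝ :=
  P.real {ω | ENNReal.ofReal γ ≤ X.sinr S ω}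

end Network

/-! ## Special functions and the formulas -/

/-- The Gauss hypergeometric function `₂F₁(a, b; c; z)` for `0 < b < c` and `z < 1`, by Euler's
integral (the power series converges for `|z| < 1` only). -/
def gaussHyp (a b c z : ℝ) : ℝ :=
  Real.Gamma c / (Real.Gamma b * Real.Gamma (c - b)) *
    ∫ t in (0 : ℝ)..1, t ^ (b - 1) * (1 - t) ^ (c - b - 1) * (1 - z * t) ^ (-a)

/-- The Beta function, for `0 < x` and `0 < y`. -/
def betaFn (x y : ℝ) : ℝ :=
  ∫ t in Set.Ioi (0 : ℝ), t ^ (x - 1) / (1 + t) ^ (x + y)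

namespace Params

variable (S : Params)

/-- `δ = 2 / α`. -/
def δ : ℝ := 2 / S.α

/-- `ρ = r ^ α γ / (P_{x₀} η)`, for a typical node at distance `r`. -/
def ρ (γ r : ℝ) : ℝ := r ^ S.α * γ / (S.Px₀ * S.η)

/-- Laplace transform of the intra-cluster interference, `n` nodes per cluster. -/
def lapIntraFixed (n : ℕ) (s : ℝ) : ℝ :=
  (S.a ^ S.α * S.δ / (s * S.Px * S.η * (S.δ + 1)) *
    gaussHyp 1 (S.δ + 1) (S.δ + 2) (-(S.a ^ S.α / (s * S.Px * S.η)))) ^ (n - 1)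

/-- Laplace transform of the intra-cluster interference, on average `nbar` nodes per cluster. -/
def lapIntraPoisson (nbar s : ℝ) : ℝ :=
  Real.exp (-((nbar - 1) * gaussHyp 1 S.δ (S.δ + 1) (-(S.a ^ S.α / (s * S.Px * S.η)))))

/-- Upper bound for the Laplace transform of the inter-cluster interference, `n` nodes per
cluster. -/
def lapInterUp (n : ℕ) (s : ℝ) : ℝ :=
  Real.exp (-(Real.pi * S.densG * (s * S.Px * S.η) ^ S.δ * S.δ *
    ∑ p ∈ Finset.Icc 1 n, (n.choose p : ℝ) * betaFn (p - S.δ) (n - p + S.δ)))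

/-- Lower bound for the Laplace transform of the inter-cluster interference, on average `nbar` nodes
per cluster. -/
def lapInterLow (nbar s : ℝ) : ℝ :=
  Real.exp (-(Real.pi ^ 2 * S.densG * nbar * (s * S.Px * S.η) ^ S.δ *
    (S.δ / Real.sin (Real.pi * S.δ))))

/-- Laplace transform of the coexistence interference. -/
def lapCo (s : ℝ) : ℝ :=
  Real.exp (-(Real.pi * S.densCo * Real.Gamma (1 + S.δ) * Real.Gamma (1 - S.δ) *
    (s * S.Pz * S.η) ^ S.δ))

/-- The integrand of the bound for `n` nodes per cluster. -/
def integrandUp (n : ℕ) (γ r : ℝ) : ℝ :=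
  Real.exp (-(S.ρ γ r * S.σ ^ 2)) * S.lapIntraFixed n (S.ρ γ r) * S.lapInterUp n (S.ρ γ r) *
    S.lapCo (S.ρ γ r) * r

/-- The integrand of the bound for on average `nbar` nodes per cluster. -/
def integrandLow (nbar γ r : ℝ) : ℝ :=
  Real.exp (-(S.ρ γ r * S.σ ^ 2)) * S.lapIntraPoisson nbar (S.ρ γ r) *
    S.lapInterLow nbar (S.ρ γ r) * S.lapCo (S.ρ γ r) * r

end Params

end

end LoRa

namespace LoRa

open Filter Topology

/-! Since the fading coefficient of the typical node is exponential with mean 1 and independent of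
everything else, the conditional probability of coverage given positions and interference is
exp(-ρ(‖x₀‖) I), where I is interference plus noise. So the coverage probability is the average,
over the uniform position x₀, of the Laplace transform of I at ρ(‖x₀‖) (`measure_coverage`). By
independence this transform is a product over intra-cluster, inter-cluster, coexistence and noise
terms (`lintegral_expNeg_Itot`).

Let v(x) = 1/(1 + c‖x‖^(-α)) be the transform for one node at x, and V(x) its mean over the disc of
radius a about x. The intra-cluster factor is the mean of V(0)^N, which Euler's integral turns into
the hypergeometric forms. The other two factors come from the Laplace functional of a marked Poisson
process (`lintegral_expNeg_marked`): exp(-λ ∫ (1 - v)) for coexistence and exp(-λ ∫ (1 - E V^N)) for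
the other clusters. The substitution w = c‖x‖^(-α) turns ∫ (1 - v^n) into a sum of Beta integrals.

Only the inter-cluster factor is estimated, using that averaging over discs preserves integrals over
the plane. For N = n, Jensen gives V^n ≤ mean of v^n, hence ∫ (1 - V^n) ≥ ∫ (1 - v^n) and an upper
bound. For Poisson N, E V^N = exp(-n̄(1 - V)), and 1 - exp(-t) ≤ t together with ∫ (1 - V) = ∫ (1 -
v) gives the lower bound.

Expectations are taken in [0, ∞] with exp(-∞) = 0, so infinite interference needs no separate
treatment. -/

/-! ## The exponential `exp (-x)` on `[0, ∞]` -/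

/-- The function `x ↦ exp (-x)` on `[0, ∞]`, with `exp (-∞) = 0`. -/
noncomputable def expNeg (x : ℝ≥0∞) : ℝ≥0∞ := EReal.exp (-(x : EReal))

@[simp] lemma expNeg_zero : expNeg 0 = 1 := by simp [expNeg]

@[simp] lemma expNeg_top : expNeg ⊤ = 0 := by simp [expNeg]

lemma continuous_expNeg : Continuous expNeg :=
  ENNReal.continuous_exp.comp (continuous_neg.comp continuous_coe_ennreal_ereal)

@[fun_prop]
lemma measurable_expNeg : Measurable expNeg := continuous_expNeg.measurable

lemma antitone_expNeg : Antitone expNeg := fun _ _ h =>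
  EReal.exp_monotone (EReal.neg_le_neg_iff.2 (EReal.coe_ennreal_le_coe_ennreal_iff.2 h))

lemma expNeg_le_one (x : ℝ≥0∞) : expNeg x ≤ 1 := by
  simpa using antitone_expNeg (zero_le (a := x))

lemma expNeg_ne_top (x : ℝ≥0∞) : expNeg x ≠ ⊤ := ((expNeg_le_one x).trans_lt ENNReal.one_lt_top).ne

/-- No finiteness is required: elements of `ℝ≥0∞` are never `⊥` in `EReal`, so ∞ - ∞ does not arise.
-/
lemma expNeg_add (x y : ℝ≥0∞) : expNeg (x + y) = expNeg x * expNeg y := by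
  rw [expNeg, EReal.coe_ennreal_add, EReal.neg_add (by simp) (by simp), sub_eq_add_neg,
    EReal.exp_add]
  rfl

lemma expNeg_sum {ι : Type*} (s : Finset ι) (f : ι → ℝ≥0∞) :
    expNeg (∑ i ∈ s, f i) = ∏ i ∈ s, expNeg (f i) := by
  classical
  induction s using Finset.induction_on with
  | empty => simp
  | insert a s ha ih => rw [Finset.sum_insert ha, Finset.prod_insert ha, expNeg_add, ih]

lemma expNeg_ofReal {t : ℝ} (ht : 0 ≤ t) :
    expNeg (ENNReal.ofReal t) = ENNReal.ofReal (Real.exp (-t)) := by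
  rw [expNeg, EReal.coe_ennreal_ofReal, max_eq_left ht, ← EReal.coe_neg, EReal.exp_coe]

/-- The inverse of `expNeg` on `[0, 1]`. -/
noncomputable def negLog (x : ℝ≥0∞) : ℝ≥0∞ := (-ENNReal.log x).toENNReal

lemma expNeg_negLog {x : ℝ≥0∞} (hx : x ≤ 1) : expNeg (negLog x) = x := by
  -- The bound x ≤ 1 makes -log x nonnegative, so `toENNReal` truncates nothing.
  have h : 0 ≤ -ENNReal.log x := by
    rw [EReal.le_neg, neg_zero]
    simpa using ENNReal.log_monotone hx
  rw [expNeg, negLog, EReal.coe_toENNReal h, neg_neg, ENNReal.exp_log]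

@[fun_prop]
lemma measurable_negLog : Measurable negLog := by
  unfold negLog
  exact (EReal.continuous_toENNReal.comp
    (continuous_neg.comp ENNReal.continuous_log)).measurable

/-- The tangent inequality for exp at 0; it is the only loss in the lower bound of the random model.
-/
lemma one_sub_expNeg_le (x : ℝ≥0∞) : 1 - expNeg x ≤ x := by
  by_cases hx : x = ⊤
  · simp [hx]
  lift x to ℝ≥0 using hx
  have h : (x : ℝ≥0∞) = ENNReal.ofReal x := by simp
  rw [h, expNeg_ofReal x.coe_nonneg, ← ENNReal.ofReal_one,
    ← ENNReal.ofReal_sub _ (Real.exp_pos _).le]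
  apply ENNReal.ofReal_le_ofReal
  linarith [Real.add_one_le_exp (-(x : ℝ))]

/-! ## Groups of independent σ-algebras -/

section Independence

variable {Ω ι : Type*}

/-- The σ-algebra generated by the members of `m` with indices in `S`. -/
@[reducible] def joint (m : ι → MeasurableSpace Ω) (S : Set ι) : MeasurableSpace Ω := ⨆ i ∈ S, m i

lemma joint_mono (m : ι → MeasurableSpace Ω) {S T : Set ι} (h : S ⊆ T) : joint m S ≤ joint m T :=
  biSup_mono h

lemma le_joint (m : ι → MeasurableSpace Ω) {S : Set ι} {i : ι} (h : i ∈ S) : m i ≤ joint m S :=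
  le_biSup m h

variable [mΩ : MeasurableSpace Ω] {P : Measure Ω} {m : ι → MeasurableSpace Ω}

lemma joint_le (hm : ∀ i, m i ≤ mΩ) (S : Set ι) : joint m S ≤ mΩ := iSup₂_le fun i _ => hm i

/-- Measurability with respect to `joint m S` records that a quantity depends on the sources in `S`
only; disjoint index sets then yield independence. All later independence arguments use this
bookkeeping. -/
lemma indepFun_of_joint {α β : Type*} [MeasurableSpace α] [MeasurableSpace β]
    (hm : ∀ i, m i ≤ mΩ) (hind : iIndep m P) {S T : Set ι} (hST : Disjoint S T)
    {f : Ω → α} {g : Ω → β} (hf : Measurable[joint m S] f) (hg : Measurable[joint m T] g) :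
    IndepFun f g P :=
  indep_of_indep_of_le_left (indep_of_indep_of_le_right (indep_iSup_of_disjoint hm hind hST)
    (measurable_iff_comap_le.1 hg)) (measurable_iff_comap_le.1 hf)

lemma lintegral_mul_of_joint (hm : ∀ i, m i ≤ mΩ) (hind : iIndep m P) {S T : Set ι}
    (hST : Disjoint S T) {f g : Ω → ℝ≥0∞}
    (hf : Measurable[joint m S] f) (hg : Measurable[joint m T] g) :
    ∫⁻ ω, f ω * g ω ∂P = (∫⁻ ω, f ω ∂P) * ∫⁻ ω, g ω ∂P :=
  lintegral_mul_eq_lintegral_mul_lintegral_of_independent_measurableSpace (joint_le hm S)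
    (joint_le hm T) (indep_iSup_of_disjoint hm hind hST) hf hg

lemma lintegral_prod_of_joint [IsProbabilityMeasure P] (hm : ∀ i, m i ≤ mΩ) (hind : iIndep m P)
    {S : ℕ → Set ι} (hS : Pairwise fun i j => Disjoint (S i) (S j)) {f : ℕ → Ω → ℝ≥0∞}
    (hf : ∀ i, Measurable[joint m (S i)] (f i)) (k : ℕ) :
    ∫⁻ ω, ∏ i ∈ Finset.range k, f i ω ∂P = ∏ i ∈ Finset.range k, ∫⁻ ω, f i ω ∂P := by
  induction k with
  | zero => simp
  | succ k ih =>
    simp_rw [Finset.prod_range_succ]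
    rw [lintegral_mul_of_joint hm hind (S := ⋃ i ∈ Finset.range k, S i) (T := S k), ih]
    · simp only [Set.disjoint_iUnion_left, Finset.mem_range]
      exact fun i hi => hS hi.ne
    · refine Finset.measurable_fun_prod _ fun i hi => (hf i).mono (joint_mono m ?_) le_rfl
      exact Set.subset_biUnion_of_mem (u := S) hi
    · exact hf k

/-- Tonelli for the joint law, which is a product. Evaluating `g` at a second outcome `ω'` plays the
role of conditioning on `f`. -/
lemma lintegral_decouple [IsProbabilityMeasure P] {α β : Type*} [MeasurableSpace α]
    [MeasurableSpace β] (hm : ∀ i, m i ≤ mΩ) (hind : iIndep m P) {S T : Set ι}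
    (hST : Disjoint S T) {f : Ω → α} {g : Ω → β} (hf : Measurable[joint m S] f)
    (hg : Measurable[joint m T] g) {F : α → β → ℝ≥0∞} (hF : Measurable (Function.uncurry F)) :
    ∫⁻ ω, F (f ω) (g ω) ∂P = ∫⁻ ω, ∫⁻ ω', F (f ω) (g ω') ∂P ∂P := by
  have hf' : Measurable f := hf.mono (joint_le hm S) le_rfl
  have hg' : Measurable g := hg.mono (joint_le hm T) le_rfl
  have h := (indepFun_iff_map_prod_eq_prod_map_map hf'.aemeasurable hg'.aemeasurable).1
    (indepFun_of_joint hm hind hST hf hg)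
  have : IsProbabilityMeasure (P.map f) := Measure.isProbabilityMeasure_map hf'.aemeasurable
  have : IsProbabilityMeasure (P.map g) := Measure.isProbabilityMeasure_map hg'.aemeasurable
  calc ∫⁻ ω, F (f ω) (g ω) ∂P
      = ∫⁻ p, Function.uncurry F p ∂(P.map fun ω => (f ω, g ω)) := by
        rw [lintegral_map hF (hf'.prodMk hg')]; rfl
    _ = ∫⁻ x, ∫⁻ y, F x y ∂(P.map g) ∂(P.map f) := by
        rw [h, lintegral_prod _ hF.aemeasurable]; rfl
    _ = _ := by
        rw [lintegral_map hF.lintegral_prod_right hf']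
        refine lintegral_congr fun ω => ?_
        exact lintegral_map (hF.comp measurable_prodMk_left) hg'

/-- The expectation of a product of a random number of independent factors. -/
lemma lintegral_prod_range_random [IsProbabilityMeasure P] (hm : ∀ i, m i ≤ mΩ)
    (hind : iIndep m P) {T : Set ι} {S : ℕ → Set ι} (hS : Pairwise fun i j => Disjoint (S i) (S j))
    (hT : ∀ i, Disjoint T (S i)) {N : Ω → ℕ} {ν : Measure ℕ} (hN : Measurable[joint m T] N)
    (hlaw : HasLaw N ν P) {f : ℕ → Ω → ℝ≥0∞} (hf : ∀ i, Measurable[joint m (S i)] (f i))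
    {V : ℝ≥0∞} (hV : ∀ i, ∫⁻ ω, f i ω ∂P = V) :
    ∫⁻ ω, ∏ i ∈ Finset.range (N ω), f i ω ∂P = ∫⁻ k, V ^ k ∂ν := by
  -- The whole sequence of factors is one random variable, independent of `N`; after decoupling, the
  -- number of factors is deterministic.
  have hg : Measurable[joint m (⋃ i, S i)] fun ω i => f i ω :=
    @measurable_pi_lambda _ _ _ (joint m (⋃ i, S i)) _ _ fun i =>
      (hf i).mono (joint_mono m (Set.subset_iUnion S i)) le_rfl
  have h := lintegral_decouple hm hind (Set.disjoint_iUnion_right.2 hT) hN hg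
    (F := fun k u => ∏ i ∈ Finset.range k, u i)
    (measurable_from_prod_countable_right fun k =>
      Finset.measurable_fun_prod (Finset.range k) (f := fun i (u : ℕ → ℝ≥0∞) => u i)
        fun i _ => measurable_pi_apply i)
  rw [h, ← hlaw.lintegral_comp (Measurable.of_discrete).aemeasurable]
  refine lintegral_congr fun ω => ?_
  rw [lintegral_prod_of_joint hm hind hS hf]
  simp [hV]

end Independence

/-! ## Laplace functionals of Poisson point processes -/

lemma expNeg_mul_natCast (c : ℝ≥0∞) (k : ℕ) : expNeg (c * k) = expNeg c ^ k := by
  simpa [mul_comm] using expNeg_sum (Finset.range k) fun _ => c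

/-- The probability generating function of the Poisson distribution. -/
lemma lintegral_pow_poissonMeasure (r : ℝ≥0) {q : ℝ≥0∞} (hq : q ≤ 1) :
    ∫⁻ k, q ^ k ∂(poissonMeasure r) = expNeg (r * (1 - q)) := by
  lift q to ℝ≥0 using (hq.trans_lt ENNReal.one_lt_top).ne
  have hq' : (q : ℝ) ≤ 1 := by exact_mod_cast hq
  have h1 : (r : ℝ≥0∞) * (1 - q) = ENNReal.ofReal (r * (1 - q)) := by
    rw [ENNReal.ofReal_mul r.coe_nonneg, ENNReal.ofReal_sub _ q.coe_nonneg]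
    simp
  have h2 : HasSum (fun k : ℕ => Real.exp (-r) * r ^ k / k.factorial * (q : ℝ) ^ k)
      (Real.exp (-(r * (1 - q)))) := by
    convert! (NormedSpace.expSeries_div_hasSum_exp ((r : ℝ) * q)).mul_left (Real.exp (-r)) using 1
    · ext k
      rw [mul_pow]
      ring
    · rw [← Real.exp_eq_exp_ℝ, ← Real.exp_add]
      ring_nf
  rw [h1, expNeg_ofReal (mul_nonneg r.coe_nonneg (by linarith)), ← h2.tsum_eq,
    ENNReal.ofReal_tsum_of_nonneg (fun k => by positivity) h2.summable, poissonMeasure,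
    lintegral_sum_measure]
  refine tsum_congr fun k => ?_
  rw [lintegral_smul_measure, lintegral_dirac, ENNReal.ofReal_mul (by positivity),
    ENNReal.ofReal_pow q.coe_nonneg, ENNReal.ofReal_coe_nnreal, smul_eq_mul]

open scoped Classical in
/-- The sum of the first `c` terms of a sequence, where `c` may be infinite. -/
noncomputable def sumUpTo (c : ℕ∞) (u : ℕ → ℝ≥0∞) : ℝ≥0∞ :=
  ∑' i : ℕ, if (i : ℕ∞) < c then u i else 0

@[fun_prop]
lemma measurable_sumUpTo : Measurable (Function.uncurry sumUpTo) := by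
  refine Measurable.tsum fun i => Measurable.ite ?_ ?_ measurable_const
  · exact measurable_fst (MeasurableSet.of_discrete (s := {c : ℕ∞ | (i : ℕ∞) < c}))
  · exact (measurable_pi_apply i).comp measurable_snd

lemma sumUpTo_finset_sum {κ : Type*} (s : Finset κ) (c : ℕ∞) (u : κ → ℕ → ℝ≥0∞) :
    sumUpTo c (fun i => ∑ k ∈ s, u k i) = ∑ k ∈ s, sumUpTo c (u k) := by
  unfold sumUpTo
  rw [← Summable.tsum_finsetSum fun _ _ => ENNReal.summable]
  refine tsum_congr fun i => ?_
  split_ifs <;> simp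

lemma sumUpTo_const_mul (a : ℝ≥0∞) (c : ℕ∞) (u : ℕ → ℝ≥0∞) :
    sumUpTo c (fun i => a * u i) = a * sumUpTo c u := by
  unfold sumUpTo
  rw [← ENNReal.tsum_mul_left]
  refine tsum_congr fun i => ?_
  split_ifs <;> simp

/-- Monotone convergence for the counting measure on the indices. -/
lemma tendsto_sumUpTo {c : ℕ∞} {u : ℕ → ℕ → ℝ≥0∞} {v : ℕ → ℝ≥0∞} (hu : Monotone u)
    (hv : ∀ i, Tendsto (fun n => u n i) atTop (𝓝 (v i))) :
    Tendsto (fun n => sumUpTo c (u n)) atTop (𝓝 (sumUpTo c v)) := by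
  unfold sumUpTo
  simp_rw [← lintegral_count]
  refine lintegral_tendsto_of_tendsto_of_monotone (fun n => Measurable.of_discrete.aemeasurable)
    (ae_of_all _ fun i n k hnk => ?_) (ae_of_all _ fun i => ?_)
  · dsimp only
    split_ifs
    exacts [hu hnk i, le_rfl]
  · split_ifs
    exacts [hv i, tendsto_const_nhds]

namespace PointProcess

variable {Ω : Type*} {Φ : PointProcess Ω}

lemma sumPoints_eq (f : ℕ → ℝ≥0∞) (ω : Ω) : Φ.sumPoints f ω = sumUpTo (Φ.count ω) f := rfl

namespace IsPoisson

variable [MeasurableSpace Ω] {P : Measure Ω} {dens : ℝ≥0}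

lemma measurable_sumPoints (hΦ : Φ.IsPoisson P dens) {f : Plane → ℝ≥0∞} (hf : Measurable f) :
    Measurable fun ω => Φ.sumPoints (fun i => f (Φ.point i ω)) ω :=
  measurable_sumUpTo.comp (hΦ.measurable_count.prodMk
    (measurable_pi_lambda _ fun i => hf.comp (hΦ.measurable_point i)))

lemma measurable_numIn (hΦ : Φ.IsPoisson P dens) {B : Set Plane} (hB : MeasurableSet B) :
    Measurable (Φ.numIn B) :=
  hΦ.measurable_sumPoints (measurable_one.indicator hB)

lemma lintegral_expNeg_numIn (hΦ : Φ.IsPoisson P dens) {B : Set Plane} (hB : MeasurableSet B)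
    (hB' : volume B ≠ ⊤) (c : ℝ≥0∞) :
    ∫⁻ ω, expNeg (c * Φ.numIn B ω) ∂P = expNeg (dens * (volume B * (1 - expNeg c))) := by
  have hm : Measurable fun x : ℝ≥0∞ => expNeg (c * x) := by fun_prop
  rw [(hΦ.hasLaw_numIn B hB hB').lintegral_comp (f := fun x => expNeg (c * x)) hm.aemeasurable,
    lintegral_map hm Measurable.of_discrete]
  simp_rw [expNeg_mul_natCast]
  rw [lintegral_pow_poissonMeasure _ (expNeg_le_one c), ENNReal.coe_mul,
    ENNReal.coe_toNNReal hB', mul_assoc]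

/-- `Φ` has the Laplace functional of a Poisson process at the function `f`. -/
def LaplaceAt (Φ : PointProcess Ω) (P : Measure Ω) (dens : ℝ≥0) (f : Plane → ℝ≥0∞) : Prop :=
  ∫⁻ ω, expNeg (Φ.sumPoints (fun i => f (Φ.point i ω)) ω) ∂P =
    expNeg (dens * ∫⁻ x, (1 - expNeg (f x)))

/-- The expectation converges by domination by 1, the integral over the plane by monotone
convergence, because 1 - exp(-·) is increasing. -/
lemma laplaceAt_of_tendsto [IsProbabilityMeasure P] (hΦ : Φ.IsPoisson P dens)
    {g : ℕ → Plane → ℝ≥0∞} {f : Plane → ℝ≥0∞} (hg : ∀ n, Measurable (g n)) (hmono : Monotone g)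
    (hlim : ∀ x, Tendsto (fun n => g n x) atTop (𝓝 (f x)))
    (h : ∀ n, LaplaceAt Φ P dens (g n)) : LaplaceAt Φ P dens f := by
  unfold LaplaceAt at h ⊢
  have hl : Tendsto (fun n => ∫⁻ ω, expNeg (Φ.sumPoints (fun i => g n (Φ.point i ω)) ω) ∂P) atTop
      (𝓝 (∫⁻ ω, expNeg (Φ.sumPoints (fun i => f (Φ.point i ω)) ω) ∂P)) := by
    refine tendsto_lintegral_of_dominated_convergence (fun _ => 1)
      (fun n => measurable_expNeg.comp (hΦ.measurable_sumPoints (hg n)))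
      (fun n => ae_of_all _ fun ω => expNeg_le_one _) (by simp) (ae_of_all _ fun ω => ?_)
    exact (continuous_expNeg.tendsto _).comp
      (tendsto_sumUpTo (fun n k hnk i => hmono hnk _) fun i => hlim _)
  have hr : Tendsto (fun n => ∫⁻ x, (1 - expNeg (g n x))) atTop
      (𝓝 (∫⁻ x, (1 - expNeg (f x)))) := by
    refine lintegral_tendsto_of_tendsto_of_monotone
      (fun n => (measurable_const.sub (measurable_expNeg.comp (hg n))).aemeasurable)
      (ae_of_all _ fun x n k hnk => tsub_le_tsub_left (antitone_expNeg (hmono hnk x)) 1)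
      (ae_of_all _ fun x => ?_)
    exact ENNReal.Tendsto.sub tendsto_const_nhds ((continuous_expNeg.tendsto _).comp (hlim x))
      (Or.inl ENNReal.one_ne_top)
  refine tendsto_nhds_unique hl ?_
  simp_rw [h]
  exact (continuous_expNeg.tendsto _).comp
    (ENNReal.Tendsto.const_mul hr (Or.inr ENNReal.coe_ne_top))

/-- The two defining properties of the Poisson process enter here: the exponential of the sum is a
product of functions of independent counts, each with a Poisson law. -/
lemma laplaceAt_simple [IsProbabilityMeasure P] (hΦ : Φ.IsPoisson P dens) {k : ℕ}
    {B : Fin k → Set Plane} (hB : ∀ i, MeasurableSet (B i)) (hB' : ∀ i, volume (B i) ≠ ⊤)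
    (hdisj : Pairwise fun i j => Disjoint (B i) (B j)) (c : Fin k → ℝ≥0∞) :
    LaplaceAt Φ P dens fun x => ∑ i, c i * (B i).indicator 1 x := by
  unfold LaplaceAt
  have hL : ∀ ω, Φ.sumPoints (fun i => ∑ j, c j * (B j).indicator 1 (Φ.point i ω)) ω =
      ∑ j, c j * Φ.numIn (B j) ω := fun ω => by
    simp_rw [numIn, sumPoints_eq, ← sumUpTo_const_mul, ← sumUpTo_finset_sum]
  -- 1 - exp(-·) is not additive, but a point lies in at most one of the disjoint sets, so at most
  -- one term is nonzero.
  have hR : ∀ x, 1 - expNeg (∑ j, c j * (B j).indicator 1 x) =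
      ∑ j, (B j).indicator (fun _ => 1 - expNeg (c j)) x := fun x => by
    by_cases hx : ∃ j, x ∈ B j
    · obtain ⟨j, hj⟩ := hx
      have hn : ∀ i, i ≠ j → x ∉ B i := fun i hij hi =>
        Set.disjoint_left.1 (hdisj hij) hi hj
      rw [Finset.sum_eq_single j, Finset.sum_eq_single j]
      · simp [hj]
      · intro i _ hij; simp [hn i hij]
      · simp
      · intro i _ hij; simp [hn i hij]
      · simp
    · push Not at hx
      simp [hx]
  have hmeas : ∀ j, Measurable fun x : ℝ≥0∞ => expNeg (c j * x) := fun j => by fun_prop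
  simp_rw [hL, hR, expNeg_sum]
  rw [lintegral_prod_eq_prod_lintegral_of_indepFun Finset.univ
    (fun j ω => expNeg (c j * Φ.numIn (B j) ω))
    ((hΦ.indep_numIn k B hB hB' hdisj).comp (fun j x => expNeg (c j * x)) hmeas)
    fun j => (hmeas j).comp (hΦ.measurable_numIn (hB j)),
    lintegral_finsetSum _ fun j _ => measurable_const.indicator (hB j), Finset.mul_sum, expNeg_sum]
  refine Finset.prod_congr rfl fun j _ => ?_
  rw [hΦ.lintegral_expNeg_numIn (hB j) (hB' j), lintegral_indicator_const (hB j), mul_comm (volume _)]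

lemma laplaceAt_simpleFunc [IsProbabilityMeasure P] (hΦ : Φ.IsPoisson P dens)
    (g : SimpleFunc Plane ℝ≥0∞) (hg : volume (Function.support g) ≠ ⊤) :
    LaplaceAt Φ P dens g := by
  classical
  -- The value 0 is dropped because its fibre has infinite area, whereas counts are controlled only
  -- on sets of finite area.
  set R := g.range.filter (· ≠ 0) with hR
  let e := R.equivFin
  have h := hΦ.laplaceAt_simple (B := fun i => g ⁻¹' {((e.symm i : R) : ℝ≥0∞)})
    (fun i => g.measurableSet_fiber _)
    (fun i => ne_top_of_le_ne_top hg (measure_mono fun x hx => by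
      have h0 : ((e.symm i : R) : ℝ≥0∞) ≠ 0 := (Finset.mem_filter.1 (e.symm i).2).2
      rw [Set.mem_preimage, Set.mem_singleton_iff] at hx
      rwa [Function.mem_support, hx]))
    (fun i j hij => Disjoint.preimage _ (by
      rw [Set.disjoint_singleton]
      exact fun h => hij (e.symm.injective (Subtype.ext h))))
    (fun i => ((e.symm i : R) : ℝ≥0∞))
  convert h using 1
  ext x
  rw [e.symm.sum_comp fun y : R => (y : ℝ≥0∞) * (g ⁻¹' {(y : ℝ≥0∞)}).indicator 1 x,
    Finset.sum_coe_sort R fun y => y * (g ⁻¹' {y}).indicator 1 x]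
  by_cases hx : g x = 0
  · rw [hx, Finset.sum_eq_zero]
    intro y hy
    have : g x ≠ y := fun h => (Finset.mem_filter.1 hy).2 (h ▸ hx)
    simp [this]
  · rw [Finset.sum_eq_single (g x)]
    · simp
    · intro y _ hy
      simp [Ne.symm hy]
    · intro h
      exact absurd (Finset.mem_filter.2 ⟨g.mem_range_self x, hx⟩) h

/-- The Laplace functional of a Poisson point process. -/
theorem laplaceAt [IsProbabilityMeasure P] (hΦ : Φ.IsPoisson P dens) {f : Plane → ℝ≥0∞}
    (hf : Measurable f) : LaplaceAt Φ P dens f := by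
  -- Two monotone limits: truncation to balls first, so that the simple functions approximating the
  -- truncation from below have support of finite area.
  refine hΦ.laplaceAt_of_tendsto (g := fun n => (Metric.ball 0 (n : ℝ)).indicator f)
    (fun n => hf.indicator Metric.isOpen_ball.measurableSet)
    (fun n k hnk => Set.indicator_le_indicator_of_subset
      (Metric.ball_subset_ball (by exact_mod_cast hnk)) fun _ => zero_le) (fun x => ?_) fun n => ?_
  · obtain ⟨N, hN⟩ := exists_nat_gt ‖x‖
    refine tendsto_const_nhds.congr' ?_
    filter_upwards [eventually_ge_atTop N] with n hn
    have : x ∈ Metric.ball (0 : Plane) n := by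
      rw [mem_ball_zero_iff]
      exact hN.trans_le (by exact_mod_cast hn)
    simp [this]
  · have hf' := hf.indicator (Metric.isOpen_ball (x := (0 : Plane)) (ε := (n : ℝ))).measurableSet
    refine hΦ.laplaceAt_of_tendsto
      (g := fun k => SimpleFunc.eapprox ((Metric.ball (0 : Plane) n).indicator f) k)
      (fun k => SimpleFunc.measurable _) (fun i j hij => SimpleFunc.monotone_eapprox _ hij)
      (fun x => ?_) fun k => hΦ.laplaceAt_simpleFunc _ ?_
    · exact SimpleFunc.tendsto_eapprox hf' x
    · refine ne_top_of_le_ne_top (measure_ball_lt_top (x := (0 : Plane)) (r := n)).ne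
        (measure_mono fun x hx => ?_)
      by_contra hx'
      refine hx (le_antisymm ?_ zero_le)
      have := le_iSup (fun k => SimpleFunc.eapprox ((Metric.ball (0 : Plane) n).indicator f) k x) k
      rw [SimpleFunc.iSup_eapprox_apply hf'] at this
      simpa [hx'] using this

end IsPoisson

variable {ι E : Type*} [MeasurableSpace E]

/-- The Laplace transform of the sum of the marks `w x (M i)` of the points of a Poisson process,
where the random variables `M i` are independent of the process and of each other. -/
theorem IsPoisson.lintegral_expNeg_marked [mΩ : MeasurableSpace Ω] {P : Measure Ω}
    [IsProbabilityMeasure P] {dens : ℝ≥0} (hΦ : Φ.IsPoisson P dens) {m : ι → MeasurableSpace Ω}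
    (hm : ∀ i, m i ≤ mΩ) (hind : iIndep m P) {T : Set ι} {S : ℕ → Set ι}
    (hS : Pairwise fun i j => Disjoint (S i) (S j)) (hT : ∀ i, Disjoint T (S i))
    (hsigma : Φ.sigma ≤ joint m T) {M : ℕ → Ω → E} (hM : ∀ i, Measurable[joint m (S i)] (M i))
    {w : Plane → E → ℝ≥0∞} (hw : Measurable (Function.uncurry w)) {G : Plane → ℝ≥0∞}
    (hG : ∀ i x, ∫⁻ ω, expNeg (w x (M i ω)) ∂P = G x) :
    ∫⁻ ω, expNeg (Φ.sumPoints (fun i => w (Φ.point i ω) (M i ω)) ω) ∂P =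
      expNeg (dens * ∫⁻ x, (1 - G x)) := by
  classical
  have hM' : ∀ i, Measurable (M i) := fun i => (hM i).mono (joint_le hm _) le_rfl
  have hG1 : ∀ x, G x ≤ 1 := fun x => by
    rw [← hG 0 x]
    exact (lintegral_mono fun ω => expNeg_le_one _).trans (by simp)
  have hGm : Measurable G := by
    have : G = fun x => ∫⁻ ω, expNeg (w x (M 0 ω)) ∂P := funext fun x => (hG 0 x).symm
    rw [this]
    have h : Measurable fun q : Plane × Ω => expNeg (w q.1 (M 0 q.2)) :=
      measurable_expNeg.comp (hw.comp (measurable_fst.prodMk ((hM' 0).comp measurable_snd)))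
    exact h.lintegral_prod_right'
  have hdata : Measurable[joint m T] fun ω => (Φ.count ω, fun i => Φ.point i ω) := by
    refine Measurable.mono ?_ hsigma le_rfl
    refine @Measurable.prodMk _ Φ.sigma _ _ _ _ _ _ ?_ ?_
    · exact (comap_measurable _).mono le_sup_left le_rfl
    · refine @measurable_pi_lambda _ _ _ Φ.sigma _ _ fun i => ?_
      exact (comap_measurable _).mono
        ((le_iSup (fun i => MeasurableSpace.comap (Φ.point i) inferInstance) i).trans le_sup_right)
        le_rfl
  have hmarks : Measurable[joint m (⋃ i, S i)] fun ω i => M i ω :=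
    @measurable_pi_lambda _ _ _ (joint m (⋃ i, S i)) _ _ fun i =>
      (hM i).mono (joint_mono m (Set.subset_iUnion S i)) le_rfl
  have hF : Measurable (Function.uncurry fun (p : ℕ∞ × (ℕ → Plane)) (u : ℕ → E) =>
      expNeg (sumUpTo p.1 fun i => w (p.2 i) (u i))) := by
    have h : Measurable fun (q : (ℕ∞ × (ℕ → Plane)) × (ℕ → E)) i => w (q.1.2 i) (q.2 i) := by
      refine measurable_pi_lambda _ fun i => hw.comp (f := fun q : (ℕ∞ × (ℕ → Plane)) × (ℕ → E) =>
        (q.1.2 i, q.2 i)) ?_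
      exact ((measurable_pi_apply i).comp (measurable_snd.comp measurable_fst)).prodMk
        ((measurable_pi_apply i).comp measurable_snd)
    exact measurable_expNeg.comp
      (measurable_sumUpTo.comp ((measurable_fst.comp measurable_fst).prodMk h))
  have h1 := lintegral_decouple hm hind (Set.disjoint_iUnion_right.2 hT) hdata hmarks hF
  -- With the points frozen, integrating out the independent marks gives the product of the G(p i).
  -- Written as exp of -∑ (-log G(p i)), it is the integrand of the unmarked Laplace functional at
  -- -log G. Infinite products are limits of finite ones.
  have h2 : ∀ (c : ℕ∞) (p : ℕ → Plane), ∫⁻ ω, expNeg (sumUpTo c fun i => w (p i) (M i ω)) ∂P =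
      expNeg (sumUpTo c fun i => negLog (G (p i))) := fun c p => by
    have hterm : ∀ i, Measurable[joint m (S i)] fun ω =>
        expNeg (if (i : ℕ∞) < c then w (p i) (M i ω) else 0) := fun i => by
      by_cases hi : (i : ℕ∞) < c
      · simp only [hi, if_true]
        exact measurable_expNeg.comp ((hw.comp measurable_prodMk_left).comp (hM i))
      · simp only [hi, if_false]
        exact measurable_const
    have hl : Tendsto (fun k => ∫⁻ ω, expNeg (∑ i ∈ Finset.range k,
        if (i : ℕ∞) < c then w (p i) (M i ω) else 0) ∂P) atTop
        (𝓝 (∫⁻ ω, expNeg (sumUpTo c fun i => w (p i) (M i ω)) ∂P)) := by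
      refine tendsto_lintegral_of_dominated_convergence (fun _ => 1) (fun k => ?_)
        (fun n => ae_of_all _ fun ω => expNeg_le_one _) (by simp) (ae_of_all _ fun ω => ?_)
      · simp_rw [expNeg_sum]
        exact Finset.measurable_fun_prod _ fun i _ => (hterm i).mono (joint_le hm _) le_rfl
      · exact (continuous_expNeg.tendsto _).comp (ENNReal.tendsto_nat_tsum _)
    have hr : Tendsto (fun k => expNeg (∑ i ∈ Finset.range k,
        if (i : ℕ∞) < c then negLog (G (p i)) else 0)) atTop
        (𝓝 (expNeg (sumUpTo c fun i => negLog (G (p i))))) :=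
      (continuous_expNeg.tendsto _).comp (ENNReal.tendsto_nat_tsum _)
    refine tendsto_nhds_unique (hl.congr fun k => ?_) hr
    simp_rw [expNeg_sum]
    rw [lintegral_prod_of_joint hm hind hS hterm]
    refine Finset.prod_congr rfl fun i _ => ?_
    by_cases hi : (i : ℕ∞) < c
    · simp only [hi, if_true, hG, expNeg_negLog (hG1 _)]
    · simp [hi]
  have h3 := hΦ.laplaceAt (f := fun x => negLog (G x)) (by fun_prop)
  unfold IsPoisson.LaplaceAt at h3
  simp only [expNeg_negLog (hG1 _)] at h3
  rw [← h3]
  simp_rw [sumPoints_eq]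
  rw [h1]
  exact lintegral_congr fun ω => h2 _ _

end PointProcess

/-! ## Rayleigh fading -/

lemma expMeasure_eq_withDensity : expMeasure 1 = volume.withDensity (exponentialPDF 1) := rfl

lemma measurable_exponentialPDF (r : ℝ) : Measurable (exponentialPDF r) :=
  (measurable_exponentialPDFReal r).ennreal_ofReal

lemma ae_pos_expMeasure : ∀ᵐ h ∂(expMeasure 1), 0 < h := by
  rw [expMeasure_eq_withDensity, ae_withDensity_iff (measurable_exponentialPDF 1)]
  filter_upwards [Measure.ae_ne volume (0 : ℝ)] with h h0 hne
  by_contra hn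
  exact hne (exponentialPDF_of_neg (lt_of_le_of_ne (not_lt.1 hn) h0))

/-- The Laplace transform of the exponential distribution. -/
lemma lintegral_expNeg_expMeasure (u : ℝ≥0∞) :
    ∫⁻ h, expNeg (ENNReal.ofReal h * u) ∂(expMeasure 1) = (1 + u)⁻¹ := by
  by_cases hu : u = ⊤
  -- The case u = ∞ occurs for a node at the origin; both sides vanish because h > 0 almost surely.
  · rw [hu, add_top, ENNReal.inv_top, lintegral_eq_zero_iff (by fun_prop)]
    filter_upwards [ae_pos_expMeasure] with h hh
    simp [ENNReal.mul_top, hh]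
  lift u to ℝ≥0 using hu
  have h1 : (0 : ℝ) < 1 + u := by positivity
  have h2 : (1 + (u : ℝ≥0∞))⁻¹ = ENNReal.ofReal (1 + u)⁻¹ := by
    rw [ENNReal.ofReal_inv_of_pos h1, ENNReal.ofReal_add zero_le_one u.coe_nonneg]
    simp
  rw [expMeasure_eq_withDensity, lintegral_withDensity_eq_lintegral_mul _
    (measurable_exponentialPDF 1) (by fun_prop)]
  -- Tilting the exponential density by exp(-hu) gives the density of rate 1 + u up to the factor
  -- 1/(1 + u).
  calc _ = ∫⁻ h, ENNReal.ofReal (1 + u)⁻¹ * exponentialPDF (1 + u) h := by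
        refine lintegral_congr fun h => ?_
        rcases lt_or_ge h 0 with hh | hh
        · simp [exponentialPDF_of_neg hh]
        · rw [Pi.mul_apply, exponentialPDF_of_nonneg hh, exponentialPDF_of_nonneg hh,
            ← ENNReal.ofReal_coe_nnreal, ← ENNReal.ofReal_mul hh,
            expNeg_ofReal (by positivity), ← ENNReal.ofReal_mul (by positivity),
            ← ENNReal.ofReal_mul (by positivity), ← mul_assoc, inv_mul_cancel₀ h1.ne', mul_assoc,
            ← Real.exp_add]
          ring_nf
    _ = _ := by
        rw [lintegral_const_mul _ (measurable_exponentialPDF _), lintegral_exponentialPDF_eq_one h1,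
          mul_one, h2]

/-- The tail of the exponential distribution. -/
lemma expMeasure_setOf_le (J : ℝ≥0∞) : expMeasure 1 {h | J ≤ ENNReal.ofReal h} = expNeg J := by
  have : IsProbabilityMeasure (expMeasure 1) := isProbabilityMeasure_expMeasure one_pos
  by_cases hJ : J = ⊤
  · simp [hJ]
  lift J to ℝ≥0 using hJ
  -- For J = 0 the set is the whole line rather than [0, ∞), since `ENNReal.ofReal` sends negative
  -- numbers to 0.
  rcases eq_or_ne J 0 with rfl | hJ0
  · simp
  have hpos : (0 : ℝ) < J := by positivity
  have hset : {h : ℝ | (J : ℝ≥0∞) ≤ ENNReal.ofReal h} = Set.Ici (J : ℝ) := by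
    ext h
    rw [Set.mem_ofPred_eq, ← ENNReal.ofReal_coe_nnreal, Set.mem_Ici]
    exact ⟨fun hh => ENNReal.ofReal_le_ofReal_iff'.1 hh |>.resolve_right (not_le.2 hpos),
      ENNReal.ofReal_le_ofReal⟩
  rw [hset, expMeasure_eq_withDensity, withDensity_apply _ measurableSet_Ici,
    setLIntegral_congr_fun (g := fun x => ENNReal.ofReal (Real.exp (-x))) measurableSet_Ici
      fun x hx => by rw [exponentialPDF_of_nonneg (hpos.le.trans hx)]; simp,
    setLIntegral_congr Ioi_ae_eq_Ici.symm, ← ofReal_integral_eq_lintegral_ofReal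
      (integrableOn_exp_neg_Ioi _) (ae_of_all _ fun x => (Real.exp_pos _).le), integral_exp_neg_Ioi,
    ← ENNReal.ofReal_coe_nnreal, expNeg_ofReal J.coe_nonneg]

/-! ## Laplace transforms of the interference -/

namespace Params

variable (S : Params)

/-- The Laplace transform, in the fading coefficient, of the power received from a node at `x`;
here `c` is the product of the argument of the Laplace transform, the transmit power and `η`. -/
noncomputable def nodeLaplace (c : ℝ) (x : Plane) : ℝ≥0∞ :=
  (1 + ENNReal.ofReal c * ‖x‖ₑ ^ (-S.α))⁻¹

@[fun_prop]
lemma measurable_nodeLaplace (c : ℝ) : Measurable (S.nodeLaplace c) := by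
  unfold nodeLaplace; fun_prop

lemma nodeLaplace_le_one (c : ℝ) (x : Plane) : S.nodeLaplace c x ≤ 1 := by
  unfold nodeLaplace
  exact ENNReal.inv_le_one.2 le_self_add

/-- The Laplace transform of the power received from a node that is uniformly distributed on the
disc of radius `a` about `x`. -/
noncomputable def discLaplace (c : ℝ) (x : Plane) : ℝ≥0∞ :=
  ∫⁻ y, S.nodeLaplace c (x + y) ∂(uniformDisc S.a)

lemma receivedPower_eq {p : ℝ} (hp : 0 ≤ p) (h : ℝ) (x : Plane) :
    S.receivedPower p h x =
      ENNReal.ofReal h * (ENNReal.ofReal (p * S.η) * ‖x‖ₑ ^ (-S.α)) := by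
  rw [receivedPower, mul_right_comm, mul_comm _ h,
    ENNReal.ofReal_mul' (mul_nonneg hp S.η_pos.le), mul_assoc]

lemma ofReal_mul_receivedPower {s p : ℝ} (hs : 0 ≤ s) (hp : 0 ≤ p) (h : ℝ) (x : Plane) :
    ENNReal.ofReal s * S.receivedPower p h x =
      ENNReal.ofReal h * (ENNReal.ofReal (s * p * S.η) * ‖x‖ₑ ^ (-S.α)) := by
  rw [S.receivedPower_eq hp, mul_assoc s, ENNReal.ofReal_mul hs]
  ring

lemma measurable_receivedPower (p : ℝ) :
    Measurable fun q : ℝ × Plane => S.receivedPower p q.1 q.2 := by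
  unfold receivedPower; fun_prop

/-- The power received from the first `N` nodes of a cluster about `x`. -/
noncomputable def clusterPower (x : Plane) (d : ℕ × (ℕ → Plane) × (ℕ → ℝ)) : ℝ≥0∞ :=
  ∑ j ∈ Finset.range d.1, S.receivedPower S.Px (d.2.2 j) (x + d.2.1 j)

lemma measurable_clusterPower : Measurable (Function.uncurry S.clusterPower) := by
  have h : Measurable fun q : ℕ × Plane × (ℕ → Plane) × (ℕ → ℝ) =>
      ∑ j ∈ Finset.range q.1, S.receivedPower S.Px (q.2.2.2 j) (q.2.1 + q.2.2.1 j) := by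
    refine measurable_from_prod_countable_right fun k => ?_
    exact Finset.measurable_fun_sum (Finset.range k)
      (f := fun j (q : Plane × (ℕ → Plane) × (ℕ → ℝ)) =>
        S.receivedPower S.Px (q.2.2 j) (q.1 + q.2.1 j))
      fun j _ => (S.measurable_receivedPower S.Px).comp
        (f := fun q : Plane × (ℕ → Plane) × (ℕ → ℝ) => (q.2.2 j, q.1 + q.2.1 j)) (by fun_prop)
  exact h.comp (f := fun q : Plane × ℕ × (ℕ → Plane) × (ℕ → ℝ) => (q.2.1, q.1, q.2.2)) (by fun_prop)

end Params

/-! ### Interference as functions of disjoint groups of sources -/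

/-- The part of the network to which a source of randomness belongs. -/
def Source.group : Source → Fin 5
  | .x₀ => 0
  | .h₀ => 1
  | .numIntra | .xIntra _ | .hIntra _ => 2
  | .receivers | .numInter _ | .xInter _ _ | .hInter _ _ => 3
  | .nonLoRa | .hCo _ => 4

/-- The sources of randomness of the `i`-th other cluster. -/
def Source.cluster (i : ℕ) : Set Source :=
  {.numInter i} ∪ Set.range (.xInter i) ∪ Set.range (.hInter i)

namespace Network

variable {Ω : Type*} {X : Network Ω} {S : Params}

lemma measurable_of_comap {α : Type*} [MeasurableSpace α] {f : Ω → α} {k : Source}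
    (h : X.sigma k = MeasurableSpace.comap f inferInstance) {T : Set Source} (hk : k ∈ T) :
    Measurable[joint X.sigma T] f :=
  measurable_iff_comap_le.2 (h ▸ le_joint X.sigma hk)

lemma measurable_data {N : Ω → ℕ} {y : ℕ → Ω → Plane} {h : ℕ → Ω → ℝ} {m : MeasurableSpace Ω}
    (hN : Measurable[m] N) (hy : ∀ j, Measurable[m] (y j)) (hh : ∀ j, Measurable[m] (h j)) :
    Measurable[m] fun ω => (N ω, (fun j => y j ω), fun j => h j ω) :=
  hN.prodMk ((@measurable_pi_lambda _ _ _ m _ _ hy).prodMk (@measurable_pi_lambda _ _ _ m _ _ hh))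

lemma Iintra_eq (ω : Ω) : X.Iintra S ω = S.clusterPower 0
    (X.numIntra ω, fun j => X.xIntra j ω, fun j => X.hIntra j ω) := by
  simp [Iintra, Params.clusterPower]

lemma Iinter_eq (ω : Ω) : X.Iinter S ω = X.receivers.sumPoints (fun i =>
    S.clusterPower (X.receivers.point i ω)
      (X.numInter i ω, fun j => X.xInter i j ω, fun j => X.hInter i j ω)) ω := rfl

lemma measurable_Iintra {T : Set Source} (hT : Source.group ⁻¹' {2} ⊆ T) :
    Measurable[joint X.sigma T] (X.Iintra S) := by
  rw [funext Iintra_eq]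
  exact (S.measurable_clusterPower.comp measurable_prodMk_left).comp (measurable_data
    (measurable_of_comap (k := .numIntra) rfl (hT rfl))
    (fun j => measurable_of_comap (k := .xIntra j) rfl (hT rfl))
    (fun j => measurable_of_comap (k := .hIntra j) rfl (hT rfl)))

lemma measurable_sumPoints {Φ : PointProcess Ω} {E : Type*} [MeasurableSpace E]
    {w : Plane → E → ℝ≥0∞} (hw : Measurable (Function.uncurry w)) {m : MeasurableSpace Ω}
    (hΦ : Φ.sigma ≤ m) {M : ℕ → Ω → E} (hM : ∀ i, Measurable[m] (M i)) :
    Measurable[m] fun ω => Φ.sumPoints (fun i => w (Φ.point i ω) (M i ω)) ω := by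
  have hc : Measurable[m] Φ.count := measurable_iff_comap_le.2 (le_sup_left.trans hΦ)
  have hp : ∀ i, Measurable[m] (Φ.point i) := fun i => measurable_iff_comap_le.2
    (((le_iSup (fun i => MeasurableSpace.comap (Φ.point i) inferInstance) i).trans
      le_sup_right).trans hΦ)
  exact measurable_sumUpTo.comp (hc.prodMk
    (@measurable_pi_lambda _ _ _ m _ _ fun i => hw.comp ((hp i).prodMk (hM i))))

lemma measurable_Iinter {T : Set Source} (hT : Source.group ⁻¹' {3} ⊆ T) :
    Measurable[joint X.sigma T] (X.Iinter S) := by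
  rw [funext Iinter_eq]
  exact measurable_sumPoints S.measurable_clusterPower
    (le_joint X.sigma (i := .receivers) (hT rfl)) fun i => measurable_data
    (measurable_of_comap (k := .numInter i) rfl (hT rfl))
    (fun j => measurable_of_comap (k := .xInter i j) rfl (hT rfl))
    (fun j => measurable_of_comap (k := .hInter i j) rfl (hT rfl))

lemma measurable_Ico {T : Set Source} (hT : Source.group ⁻¹' {4} ⊆ T) :
    Measurable[joint X.sigma T] (X.Ico S) :=
  measurable_sumPoints (w := fun x h => S.receivedPower S.Pz h x)
    ((S.measurable_receivedPower S.Pz).comp measurable_swap)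
    (le_joint X.sigma (i := .nonLoRa) (hT rfl))
    fun i => measurable_of_comap (k := .hCo i) rfl (hT rfl)

/-- The total interference and noise power. -/
noncomputable def Itot (X : Network Ω) (S : Params) (ω : Ω) : ℝ≥0∞ :=
  X.Iintra S ω + X.Iinter S ω + X.Ico S ω + ENNReal.ofReal (S.σ ^ 2)

lemma measurable_Itot {T : Set Source} (hT : Source.group ⁻¹' {2, 3, 4} ⊆ T) :
    Measurable[joint X.sigma T] (X.Itot S) := by
  have h2 := measurable_Iintra (X := X) (S := S) (T := T)
    ((Set.preimage_mono (by simp)).trans hT)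
  have h3 := measurable_Iinter (X := X) (S := S) (T := T)
    ((Set.preimage_mono (by simp)).trans hT)
  have h4 := measurable_Ico (X := X) (S := S) (T := T)
    ((Set.preimage_mono (by simp)).trans hT)
  exact ((h2.add h3).add h4).add_const _

variable [mΩ : MeasurableSpace Ω] {P : Measure Ω} {ν₀ ν : Measure ℕ}

namespace IsMatern

lemma sigma_le (hX : X.IsMatern P S ν₀ ν) (k : Source) : X.sigma k ≤ mΩ := by
  have hpp : ∀ {Φ : PointProcess Ω} {d : ℝ≥0}, Φ.IsPoisson P d → Φ.sigma ≤ mΩ := fun h =>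
    sup_le h.measurable_count.comap_le (iSup_le fun i => (h.measurable_point i).comap_le)
  cases k with
  | x₀ => exact hX.measurable_x₀.comap_le
  | h₀ => exact hX.measurable_h₀.comap_le
  | numIntra => exact hX.measurable_numIntra.comap_le
  | xIntra j => exact (hX.measurable_xIntra j).comap_le
  | hIntra j => exact (hX.measurable_hIntra j).comap_le
  | receivers => exact hpp hX.receivers_poisson
  | numInter i => exact (hX.measurable_numInter i).comap_le
  | xInter i j => exact (hX.measurable_xInter i j).comap_le
  | hInter i j => exact (hX.measurable_hInter i j).comap_le
  | nonLoRa => exact hpp hX.nonLoRa_poisson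
  | hCo i => exact (hX.measurable_hCo i).comap_le

variable [IsProbabilityMeasure P]

/-- The Laplace transform of the power received from a node at a random location. -/
lemma lintegral_expNeg_node (hX : X.IsMatern P S ν₀ ν) {y : Ω → Plane} {h : Ω → ℝ} {k l : Source}
    (hkl : k ≠ l) (hk : X.sigma k = MeasurableSpace.comap y inferInstance)
    (hl : X.sigma l = MeasurableSpace.comap h inferInstance) {μ : Measure Plane}
    (hy : HasLaw y μ P) (hh : HasLaw h (expMeasure 1) P) {s p : ℝ} (hs : 0 ≤ s) (hp : 0 ≤ p)
    (x : Plane) :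
    ∫⁻ ω, expNeg (ENNReal.ofReal s * S.receivedPower p (h ω) (x + y ω)) ∂P =
      ∫⁻ y, S.nodeLaplace (s * p * S.η) (x + y) ∂μ := by
  have hF : Measurable (Function.uncurry fun (y : Plane) (h : ℝ) =>
      expNeg (ENNReal.ofReal s * S.receivedPower p h (x + y))) :=
    measurable_expNeg.comp (((S.measurable_receivedPower p).comp
      (f := fun q : Plane × ℝ => (q.2, x + q.1)) (by fun_prop)).const_mul _)
  rw [lintegral_decouple hX.sigma_le hX.indep (S := {k}) (T := {l}) (by simpa using hkl)
    (measurable_of_comap hk rfl) (measurable_of_comap hl rfl) hF,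
    ← hy.lintegral_comp (f := fun y => S.nodeLaplace (s * p * S.η) (x + y))
      (by fun_prop)]
  refine lintegral_congr fun ω => ?_
  simp_rw [S.ofReal_mul_receivedPower hs hp]
  rw [hh.lintegral_comp (f := fun t => expNeg (ENNReal.ofReal t *
    (ENNReal.ofReal (s * p * S.η) * ‖x + y ω‖ₑ ^ (-S.α)))) (by fun_prop),
    lintegral_expNeg_expMeasure]
  rfl

/-- The Laplace transform of the power received from a cluster about `x`. -/
lemma lintegral_expNeg_clusterPower (hX : X.IsMatern P S ν₀ ν) {N : Ω → ℕ} {y : ℕ → Ω → Plane}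
    {h : ℕ → Ω → ℝ} {kN : Source} {ky kh : ℕ → Source}
    (hN : X.sigma kN = MeasurableSpace.comap N inferInstance)
    (hy : ∀ j, X.sigma (ky j) = MeasurableSpace.comap (y j) inferInstance)
    (hh : ∀ j, X.sigma (kh j) = MeasurableSpace.comap (h j) inferInstance)
    (hky : Function.Injective ky) (hkh : Function.Injective kh) (hyh : ∀ i j, ky i ≠ kh j)
    (hNy : ∀ j, kN ≠ ky j) (hNh : ∀ j, kN ≠ kh j) {κ : Measure ℕ} (lawN : HasLaw N κ P)
    (lawy : ∀ j, HasLaw (y j) (uniformDisc S.a) P) (lawh : ∀ j, HasLaw (h j) (expMeasure 1) P)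
    {s : ℝ} (hs : 0 ≤ s) (x : Plane) :
    ∫⁻ ω, expNeg (ENNReal.ofReal s *
      S.clusterPower x (N ω, fun j => y j ω, fun j => h j ω)) ∂P =
      ∫⁻ k, S.discLaplace (s * S.Px * S.η) x ^ k ∂κ := by
  simp_rw [Params.clusterPower, Finset.mul_sum, expNeg_sum]
  refine lintegral_prod_range_random hX.sigma_le hX.indep (T := {kN})
    (S := fun j => {ky j, kh j}) (fun i j hij => ?_) (fun j => ?_) (measurable_of_comap hN rfl) lawN
    (f := fun j ω => expNeg (ENNReal.ofReal s * S.receivedPower S.Px (h j ω) (x + y j ω)))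
    (fun j => ?_) fun j => ?_
  · simp [hky.ne hij.symm, hkh.ne hij.symm, hyh j i, (hyh i j).symm]
  · simp [hNy, hNh]
  · have hy' : Measurable[joint X.sigma {ky j, kh j}] (y j) := measurable_of_comap (hy j) (by simp)
    have hh' : Measurable[joint X.sigma {ky j, kh j}] (h j) := measurable_of_comap (hh j) (by simp)
    exact measurable_expNeg.comp (((S.measurable_receivedPower S.Px).comp
      (hh'.prodMk (hy'.const_add x))).const_mul _)
  · exact hX.lintegral_expNeg_node (hyh j j) (hy j) (hh j) (lawy j) (lawh j) hs S.Px_pos.le x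

lemma lintegral_expNeg_Iintra (hX : X.IsMatern P S ν₀ ν) {s : ℝ} (hs : 0 ≤ s) :
    ∫⁻ ω, expNeg (ENNReal.ofReal s * X.Iintra S ω) ∂P =
      ∫⁻ k, S.discLaplace (s * S.Px * S.η) 0 ^ k ∂ν₀ := by
  simp_rw [Iintra_eq]
  exact hX.lintegral_expNeg_clusterPower (kN := .numIntra) (ky := .xIntra) (kh := .hIntra) rfl
    (fun _ => rfl) (fun _ => rfl) (fun _ _ h => by simpa using h) (fun _ _ h => by simpa using h)
    (by simp) (by simp) (by simp) hX.law_numIntra hX.law_xIntra hX.law_hIntra hs 0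

/-- Each receiver carries its entire cluster (number, displacements, fading) as its mark; different
clusters use disjoint sources. -/
lemma lintegral_expNeg_Iinter (hX : X.IsMatern P S ν₀ ν) {s : ℝ} (hs : 0 ≤ s) :
    ∫⁻ ω, expNeg (ENNReal.ofReal s * X.Iinter S ω) ∂P =
      expNeg (S.densG * ∫⁻ x, (1 - ∫⁻ k, S.discLaplace (s * S.Px * S.η) x ^ k ∂ν)) := by
  simp_rw [Iinter_eq, PointProcess.sumPoints_eq, ← sumUpTo_const_mul, ← PointProcess.sumPoints_eq]
  refine hX.receivers_poisson.lintegral_expNeg_marked hX.sigma_le hX.indep (T := {.receivers})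
    (S := Source.cluster) (fun i j hij => ?_) (fun i => ?_)
    (le_joint X.sigma (i := .receivers) rfl)
    (M := fun i ω => (X.numInter i ω, fun j => X.xInter i j ω, fun j => X.hInter i j ω))
    (fun i => ?_) (w := fun x d => ENNReal.ofReal s * S.clusterPower x d)
    (S.measurable_clusterPower.const_mul _) fun i x => ?_
  · refine Set.disjoint_left.2 ?_
    rintro k ((rfl | ⟨l, rfl⟩) | ⟨l, rfl⟩) <;> simp [Source.cluster, hij, hij.symm]
  · simp [Source.cluster]
  · exact measurable_data (measurable_of_comap (k := .numInter i) rfl (by simp [Source.cluster]))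
      (fun j => measurable_of_comap (k := .xInter i j) rfl (by simp [Source.cluster]))
      (fun j => measurable_of_comap (k := .hInter i j) rfl (by simp [Source.cluster]))
  · exact hX.lintegral_expNeg_clusterPower (kN := .numInter i) (ky := .xInter i) (kh := .hInter i)
      rfl (fun _ => rfl) (fun _ => rfl) (fun _ _ h => by simpa using h)
      (fun _ _ h => by simpa using h) (by simp) (by simp) (by simp) (hX.law_numInter i)
      (hX.law_xInter i) (hX.law_hInter i) hs x

lemma lintegral_expNeg_Ico (hX : X.IsMatern P S ν₀ ν) {s : ℝ} (hs : 0 ≤ s) :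
    ∫⁻ ω, expNeg (ENNReal.ofReal s * X.Ico S ω) ∂P =
      expNeg (S.densCo * ∫⁻ x, (1 - S.nodeLaplace (s * S.Pz * S.η) x)) := by
  simp_rw [Ico, PointProcess.sumPoints_eq, ← sumUpTo_const_mul, ← PointProcess.sumPoints_eq]
  refine hX.nonLoRa_poisson.lintegral_expNeg_marked hX.sigma_le hX.indep (T := {.nonLoRa})
    (S := fun i => {.hCo i}) (fun i j hij => ?_) (fun i => ?_)
    (le_joint X.sigma (i := .nonLoRa) rfl) (M := X.hCo)
    (fun i => measurable_of_comap (k := .hCo i) rfl rfl)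
    (w := fun x h => ENNReal.ofReal s * S.receivedPower S.Pz h x) ?_ fun i x => ?_
  · simp [hij]
  · simp
  · exact ((S.measurable_receivedPower S.Pz).comp measurable_swap).const_mul _
  · simp_rw [S.ofReal_mul_receivedPower hs S.Pz_pos.le]
    rw [(hX.law_hCo i).lintegral_comp (f := fun t => expNeg (ENNReal.ofReal t *
      (ENNReal.ofReal (s * S.Pz * S.η) * ‖x‖ₑ ^ (-S.α)))) (by fun_prop),
      lintegral_expNeg_expMeasure]
    rfl

lemma lintegral_expNeg_Itot (hX : X.IsMatern P S ν₀ ν) {s : ℝ} (hs : 0 ≤ s) :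
    ∫⁻ ω, expNeg (ENNReal.ofReal s * X.Itot S ω) ∂P =
      (∫⁻ k, S.discLaplace (s * S.Px * S.η) 0 ^ k ∂ν₀) *
      expNeg (S.densG * ∫⁻ x, (1 - ∫⁻ k, S.discLaplace (s * S.Px * S.η) x ^ k ∂ν)) *
      expNeg (S.densCo * ∫⁻ x, (1 - S.nodeLaplace (s * S.Pz * S.η) x)) *
      ENNReal.ofReal (Real.exp (-(s * S.σ ^ 2))) := by
  have hm : Measurable fun u => expNeg (ENNReal.ofReal s * u) := by fun_prop
  -- The intra and inter terms are needed twice: over their own groups to split them from each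
  -- other, and over the union of both groups to split their product from the coexistence term.
  have h2 := hm.comp (measurable_Iintra (X := X) (S := S) subset_rfl)
  have h2' := hm.comp (measurable_Iintra (X := X) (S := S) (T := Source.group ⁻¹' {2, 3})
    (Set.preimage_mono (by simp)))
  have h3 := hm.comp (measurable_Iinter (X := X) (S := S) subset_rfl)
  have h3' := hm.comp (measurable_Iinter (X := X) (S := S) (T := Source.group ⁻¹' {2, 3})
    (Set.preimage_mono (by simp)))
  have h4 := hm.comp (measurable_Ico (X := X) (S := S) subset_rfl)
  have h23 := lintegral_mul_of_joint hX.sigma_le hX.indep (Disjoint.preimage _ (by simp)) h2 h3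
  have h234 := lintegral_mul_of_joint hX.sigma_le hX.indep
    (Disjoint.preimage _ (by simp)) (h2'.mul h3') h4
  simp only [Function.comp_apply, Pi.mul_apply] at h23 h234
  simp_rw [Itot, mul_add, expNeg_add]
  rw [lintegral_mul_const' _ _ (expNeg_ne_top _), h234, h23, hX.lintegral_expNeg_Iintra hs,
    hX.lintegral_expNeg_Iinter hs, hX.lintegral_expNeg_Ico hs, ← ENNReal.ofReal_mul hs,
    expNeg_ofReal (by positivity)]

/-- The coverage event in terms of the fading coefficient of the typical node. -/
lemma _root_.LoRa.Params.le_receivedPower_div_iff (S : Params) {γ : ℝ} (hγ : 0 < γ) {h : ℝ}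
    (hh : 0 < h) {x : Plane} (hx : x ≠ 0) (J : ℝ≥0∞) :
    ENNReal.ofReal γ ≤ S.receivedPower S.Px₀ h x / J ↔
      ENNReal.ofReal (S.ρ γ ‖x‖) * J ≤ ENNReal.ofReal h := by
  have hx' : 0 < ‖x‖ := norm_pos_iff.2 hx
  have hc : 0 < S.Px₀ * S.η := mul_pos S.Px₀_pos S.η_pos
  have hu : 0 < S.Px₀ * S.η * ‖x‖ ^ (-S.α) := by positivity
  have hrp : S.receivedPower S.Px₀ h x =
      ENNReal.ofReal h * ENNReal.ofReal (S.Px₀ * S.η * ‖x‖ ^ (-S.α)) := by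
    rw [S.receivedPower_eq S.Px₀_pos.le, ← ofReal_norm,
      ENNReal.ofReal_rpow_of_pos hx', ENNReal.ofReal_mul hc.le]
  -- ρ is the threshold divided by the mean received power, which then cancels from both sides.
  have hρ : ENNReal.ofReal γ =
      ENNReal.ofReal (S.ρ γ ‖x‖) * ENNReal.ofReal (S.Px₀ * S.η * ‖x‖ ^ (-S.α)) := by
    rw [← ENNReal.ofReal_mul' hu.le, Params.ρ, Real.rpow_neg hx'.le]
    congr 1
    have : ‖x‖ ^ S.α ≠ 0 := (Real.rpow_pos_of_pos hx' _).ne'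
    have h1 := S.Px₀_pos.ne'
    have h2 := S.η_pos.ne'
    field_simp
  have hu0 : ENNReal.ofReal (S.Px₀ * S.η * ‖x‖ ^ (-S.α)) ≠ 0 := by simpa using hu
  have hh0 : ENNReal.ofReal h ≠ 0 := by simpa using hh
  -- The signal is neither 0 nor ∞, so the division is harmless even for J = 0 or J = ∞.
  rw [hrp, ENNReal.le_div_iff_mul_le (Or.inr (mul_ne_zero hh0 hu0))
    (Or.inr (ENNReal.mul_ne_top ENNReal.ofReal_ne_top ENNReal.ofReal_ne_top)), hρ, mul_right_comm,
    ENNReal.mul_le_mul_iff_left hu0 ENNReal.ofReal_ne_top]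

/-- The coverage probability is the mean of the Laplace transform of the interference and noise
power at the random point `ρ`. -/
lemma measure_coverage (hX : X.IsMatern P S ν₀ ν) {γ : ℝ} (hγ : 0 < γ) :
    P {ω | ENNReal.ofReal γ ≤ X.sinr S ω} =
      ∫⁻ x, ∫⁻ ω, expNeg (ENNReal.ofReal (S.ρ γ ‖x‖) * X.Itot S ω) ∂P ∂(uniformDisc S.a) := by
  have hρ : Measurable fun x : Plane => ENNReal.ofReal (S.ρ γ ‖x‖) := by
    unfold Params.ρ; fun_prop
  have hpos : ∀ᵐ ω ∂P, 0 < X.h₀ ω :=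
    (hX.law_h₀.ae_iff (measurableSet_setOfPred.1 measurableSet_Ioi)).2 ae_pos_expMeasure
  have hne : ∀ᵐ ω ∂P, X.x₀ ω ≠ 0 := by
    refine (hX.law_x₀.ae_iff (p := fun x => x ≠ 0)
      (measurableSet_setOfPred.1 (measurableSet_singleton (0 : Plane)).compl)).2 ?_
    exact cond_absolutelyContinuous.ae_le (Measure.ae_ne volume 0)
  have hJ : Measurable[joint X.sigma (Source.group ⁻¹' {0, 2, 3, 4})] fun ω =>
      ENNReal.ofReal (S.ρ γ ‖X.x₀ ω‖) * X.Itot S ω :=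
    (hρ.comp (measurable_of_comap (k := .x₀) rfl (by simp [Source.group]))).mul
      (measurable_Itot (Set.preimage_mono (by simp)))
  have hh₀ : Measurable[joint X.sigma (Source.group ⁻¹' {1})] X.h₀ :=
    measurable_of_comap (k := .h₀) rfl (by simp [Source.group])
  have hset : MeasurableSet {q : ℝ≥0∞ × ℝ | q.1 ≤ ENNReal.ofReal q.2} :=
    measurableSet_le measurable_fst (by fun_prop)
  have hae : {ω | ENNReal.ofReal γ ≤ X.sinr S ω} =ᵐ[P]
      (fun ω => (ENNReal.ofReal (S.ρ γ ‖X.x₀ ω‖) * X.Itot S ω, X.h₀ ω)) ⁻¹'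
        {q : ℝ≥0∞ × ℝ | q.1 ≤ ENNReal.ofReal q.2} := by
    rw [eventuallyEq_set]
    filter_upwards [hpos, hne] with ω h1 h2
    exact S.le_receivedPower_div_iff hγ h1 h2 _
  rw [measure_congr hae, ← lintegral_indicator_one
    (((hJ.mono (joint_le hX.sigma_le _) le_rfl).prodMk hX.measurable_h₀) hset)]
  -- Two decouplings: this one integrates out the typical fading coefficient and produces its
  -- exponential tail; the next separates the typical position from the interference.
  have h1 := lintegral_decouple hX.sigma_le hX.indep (Disjoint.preimage _ (by simp)) hJ hh₀
    (F := fun J h => {q : ℝ≥0∞ × ℝ | q.1 ≤ ENNReal.ofReal q.2}.indicator 1 (J, h))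
    (measurable_one.indicator hset)
  have h2 := lintegral_decouple hX.sigma_le hX.indep (S := Source.group ⁻¹' {0})
    (T := Source.group ⁻¹' {2, 3, 4}) (Disjoint.preimage _ (by simp))
    (measurable_of_comap (k := .x₀) (f := X.x₀) rfl (by simp [Source.group]))
    (measurable_Itot (X := X) (S := S) subset_rfl)
    (F := fun x I => expNeg (ENNReal.ofReal (S.ρ γ ‖x‖) * I))
    (measurable_expNeg.comp ((hρ.comp measurable_fst).mul measurable_snd))
  refine h1.trans (Eq.trans (lintegral_congr fun ω => ?_) (h2.trans ?_))
  · rw [← expMeasure_setOf_le, ← hX.law_h₀.measure_eq, ← lintegral_indicator_one]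
    · rfl
    · exact measurableSet_le measurable_const hX.measurable_h₀.ennreal_ofReal
    · exact measurableSet_le measurable_const ENNReal.measurable_ofReal
  · refine hX.law_x₀.lintegral_comp
      (f := fun x => ∫⁻ ω, expNeg (ENNReal.ofReal (S.ρ γ ‖x‖) * X.Itot S ω) ∂P) ?_
    have hI : Measurable (X.Itot S) :=
      (measurable_Itot subset_rfl).mono (joint_le hX.sigma_le _) le_rfl
    have : Measurable fun q : Plane × Ω =>
        expNeg (ENNReal.ofReal (S.ρ γ ‖q.1‖) * X.Itot S q.2) :=
      measurable_expNeg.comp ((hρ.comp measurable_fst).mul (hI.comp measurable_snd))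
    exact this.lintegral_prod_right'.aemeasurable

end IsMatern

end Network

/-! ## The Beta function -/

lemma lintegral_rpow_mul_exp {a r : ℝ} (ha : 0 < a) (hr : 0 < r) :
    ∫⁻ t in Set.Ioi (0 : ℝ), ENNReal.ofReal (t ^ (a - 1) * Real.exp (-(r * t))) =
      ENNReal.ofReal ((1 / r) ^ a * Real.Gamma a) := by
  have h := Real.integral_rpow_mul_exp_neg_mul_Ioi ha hr
  have hpos : 0 < (1 / r) ^ a * Real.Gamma a :=
    mul_pos (by positivity) (Real.Gamma_pos_of_pos ha)
  -- A Bochner integral with nonzero value forces integrability.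
  rw [← h, ofReal_integral_eq_lintegral_ofReal (Integrable.of_integral_ne_zero (by
    rw [h]; exact hpos.ne'))]
  filter_upwards [ae_restrict_mem measurableSet_Ioi] with t ht
  have : (0 : ℝ) < t := ht
  simp only [Pi.zero_apply]
  positivity

/-- Tonelli for t^(x-1) s^(x+y-1) exp(-(1+t)s) on the quadrant: integrating s first gives Γ(x+y)
times the Beta integral, t first gives Γ(x)Γ(y). -/
lemma lintegral_beta {x y : ℝ} (hx : 0 < x) (hy : 0 < y) :
    ∫⁻ t in Set.Ioi (0 : ℝ), ENNReal.ofReal (t ^ (x - 1) / (1 + t) ^ (x + y)) =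
      ENNReal.ofReal (Real.Gamma x * Real.Gamma y / Real.Gamma (x + y)) := by
  have hxy : 0 < x + y := add_pos hx hy
  have hG := Real.Gamma_pos_of_pos hxy
  have hGx := Real.Gamma_pos_of_pos hx
  set F : ℝ → ℝ → ℝ≥0∞ := fun t s =>
    ENNReal.ofReal (t ^ (x - 1) * s ^ (x + y - 1) * Real.exp (-((1 + t) * s))) with hF
  have hmeas : Measurable (Function.uncurry F) := by
    rw [hF]; unfold Function.uncurry; fun_prop
  have h1 : ∀ t ∈ Set.Ioi (0 : ℝ), ∫⁻ s in Set.Ioi (0 : ℝ), F t s =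
      ENNReal.ofReal (Real.Gamma (x + y)) * ENNReal.ofReal (t ^ (x - 1) / (1 + t) ^ (x + y)) := by
    intro t ht
    have ht' : (0 : ℝ) < t := ht
    calc ∫⁻ s in Set.Ioi (0 : ℝ), F t s
        = ∫⁻ s in Set.Ioi (0 : ℝ), ENNReal.ofReal (t ^ (x - 1)) *
            ENNReal.ofReal (s ^ (x + y - 1) * Real.exp (-((1 + t) * s))) := by
          refine lintegral_congr fun s => ?_
          rw [← ENNReal.ofReal_mul (by positivity), hF]
          ring_nf
      _ = _ := by
          rw [lintegral_const_mul _ (by fun_prop), lintegral_rpow_mul_exp hxy (by positivity),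
            ← ENNReal.ofReal_mul (by positivity), ← ENNReal.ofReal_mul hG.le,
            Real.div_rpow zero_le_one (by positivity), Real.one_rpow]
          ring_nf
  have h2 : ∀ s ∈ Set.Ioi (0 : ℝ), ∫⁻ t in Set.Ioi (0 : ℝ), F t s =
      ENNReal.ofReal (Real.Gamma x) *
        ENNReal.ofReal (s ^ (y - 1) * Real.exp (-(1 * s))) := by
    intro s hs
    have hs' : (0 : ℝ) < s := hs
    calc ∫⁻ t in Set.Ioi (0 : ℝ), F t s
        = ∫⁻ t in Set.Ioi (0 : ℝ), ENNReal.ofReal (s ^ (x + y - 1) * Real.exp (-s)) *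
            ENNReal.ofReal (t ^ (x - 1) * Real.exp (-(s * t))) := by
          refine lintegral_congr fun t => ?_
          rw [← ENNReal.ofReal_mul (by positivity), hF]
          dsimp only
          rw [show -((1 + t) * s) = -s + -(s * t) by ring, Real.exp_add]
          ring_nf
      _ = _ := by
          rw [lintegral_const_mul _ (by fun_prop), lintegral_rpow_mul_exp hx hs',
            ← ENNReal.ofReal_mul (by positivity), ← ENNReal.ofReal_mul hGx.le,
            Real.div_rpow zero_le_one hs'.le, Real.one_rpow,
            show x + y - 1 = (y - 1) + x by ring, Real.rpow_add hs', one_mul]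
          congr 1
          have := (Real.rpow_pos_of_pos hs' x).ne'
          field_simp
  have key : ENNReal.ofReal (Real.Gamma (x + y)) *
      ∫⁻ t in Set.Ioi (0 : ℝ), ENNReal.ofReal (t ^ (x - 1) / (1 + t) ^ (x + y)) =
      ENNReal.ofReal (Real.Gamma x) * ENNReal.ofReal (Real.Gamma y) := by
    rw [← lintegral_const_mul _ (by fun_prop), ← setLIntegral_congr_fun measurableSet_Ioi h1,
      lintegral_lintegral_swap hmeas.aemeasurable, setLIntegral_congr_fun measurableSet_Ioi h2,
      lintegral_const_mul _ (by fun_prop), lintegral_rpow_mul_exp hy one_pos]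
    simp
  rw [mul_div_assoc, ENNReal.ofReal_mul hGx.le, ENNReal.ofReal_div_of_pos hG, ← mul_div_assoc,
    ENNReal.eq_div_iff (by simpa using hG) ENNReal.ofReal_ne_top, key]

lemma integrableOn_beta {x y : ℝ} (hx : 0 < x) (hy : 0 < y) :
    IntegrableOn (fun t : ℝ => t ^ (x - 1) / (1 + t) ^ (x + y)) (Set.Ioi 0) := by
  refine ⟨Measurable.aestronglyMeasurable (by fun_prop), ?_⟩
  rw [hasFiniteIntegral_iff_ofReal, lintegral_beta hx hy]
  · exact ENNReal.ofReal_lt_top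
  · filter_upwards [ae_restrict_mem measurableSet_Ioi] with t ht
    have : (0 : ℝ) < t := ht
    simp only [Pi.zero_apply]
    positivity

lemma betaFn_eq {x y : ℝ} (hx : 0 < x) (hy : 0 < y) :
    betaFn x y = Real.Gamma x * Real.Gamma y / Real.Gamma (x + y) := by
  have hx' := Real.Gamma_pos_of_pos hx
  have hy' := Real.Gamma_pos_of_pos hy
  have hxy := Real.Gamma_pos_of_pos (add_pos hx hy)
  rw [betaFn, integral_eq_lintegral_of_nonneg_ae _ (integrableOn_beta hx hy).1, lintegral_beta hx hy,
    ENNReal.toReal_ofReal (by positivity)]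
  filter_upwards [ae_restrict_mem measurableSet_Ioi] with t ht
  have : (0 : ℝ) < t := ht
  simp only [Pi.zero_apply]
  positivity

/-! ## Radial integrals over the plane -/

lemma measureReal_ball_plane : (volume : Measure Plane).real (Metric.ball 0 1) = Real.pi := by
  rw [Measure.real, EuclideanSpace.volume_ball_fin_two]
  simp [Real.pi_pos.le]

lemma lintegral_radial {f : ℝ → ℝ} (hf : ∀ r, 0 ≤ r → 0 ≤ f r)
    (hint : IntegrableOn (fun r => r * f r) (Set.Ioi 0)) :
    ∫⁻ x : Plane, ENNReal.ofReal (f ‖x‖) =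
      ENNReal.ofReal (2 * Real.pi * ∫ r in Set.Ioi (0 : ℝ), r * f r) := by
  have hd : Module.finrank ℝ Plane = 2 := by simp
  have hi : Integrable (fun x : Plane => f ‖x‖) := by
    rw [integrable_fun_norm_addHaar, hd]
    simpa using hint
  rw [← ofReal_integral_eq_lintegral_ofReal hi (ae_of_all _ fun x => hf _ (norm_nonneg x)),
    integral_fun_norm_addHaar, hd, measureReal_ball_plane]
  simp [mul_assoc]

/-- Integration over the plane of a function of a power of the distance to the origin. -/
lemma lintegral_comp_norm_rpow {F : ℝ → ℝ} (hF : ∀ w, 0 ≤ w → 0 ≤ F w) {c p : ℝ} (hc : 0 < c)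
    (hp : p ≠ 0) (hint : IntegrableOn (fun w => w ^ (2 / p - 1) * F w) (Set.Ioi 0)) :
    ∫⁻ x : Plane, ENNReal.ofReal (F (c * ‖x‖ ^ p)) =
      ENNReal.ofReal (2 * Real.pi / |p| * c ^ (-(2 / p)) *
        ∫ w in Set.Ioi (0 : ℝ), w ^ (2 / p - 1) * F w) := by
  -- Polar coordinates lead to r F(c r^p). The substitution u = r^p turns this into `g` up to the
  -- factor |p|, and w = cu removes c. The exponent p may be negative.
  set g : ℝ → ℝ := fun u => u ^ (2 / p - 1) * F (c * u) with hg
  have hp' : |p| ≠ 0 := abs_ne_zero.2 hp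
  have hg1 : Set.EqOn g (fun u => c ^ (1 - 2 / p) * ((c * u) ^ (2 / p - 1) * F (c * u)))
      (Set.Ioi 0) := fun u hu => by
    have hu' : (0 : ℝ) < u := hu
    rw [hg]
    dsimp only
    rw [Real.mul_rpow hc.le hu'.le, show 1 - 2 / p = -(2 / p - 1) by ring, Real.rpow_neg hc.le]
    have := (Real.rpow_pos_of_pos hc (2 / p - 1)).ne'
    field_simp
  have hgi : IntegrableOn g (Set.Ioi 0) := by
    rw [integrableOn_congr_fun hg1 measurableSet_Ioi]
    refine Integrable.const_mul ?_ _
    have := (integrableOn_Ioi_comp_mul_left_iff (fun w => w ^ (2 / p - 1) * F w) 0 hc).2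
    rw [mul_zero] at this
    exact this hint
  have hgint : ∫ u in Set.Ioi (0 : ℝ), g u =
      c ^ (-(2 / p)) * ∫ w in Set.Ioi (0 : ℝ), w ^ (2 / p - 1) * F w := by
    rw [setIntegral_congr_fun measurableSet_Ioi hg1, integral_const_mul,
      integral_comp_mul_left_Ioi (fun w => w ^ (2 / p - 1) * F w) 0 hc, mul_zero, smul_eq_mul,
      ← mul_assoc, ← Real.rpow_neg_one c, ← Real.rpow_add hc]
    ring_nf
  have hcomp : Set.EqOn (fun r : ℝ => (|p| * r ^ (p - 1)) • g (r ^ p))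
      (fun r => |p| * (r * F (c * r ^ p))) (Set.Ioi 0) := fun r hr => by
    have hr' : (0 : ℝ) < r := hr
    have h1 : r ^ (p - 1) * (r ^ p) ^ (2 / p - 1) = r := by
      rw [← Real.rpow_mul hr'.le, ← Real.rpow_add hr',
        show p - 1 + p * (2 / p - 1) = 1 by field_simp; ring, Real.rpow_one]
    rw [hg]
    dsimp only
    rw [smul_eq_mul, ← mul_assoc, mul_assoc |p|, h1, mul_assoc]
  have hi := (integrableOn_Ioi_comp_rpow_iff g hp).2 hgi
  rw [integrableOn_congr_fun hcomp measurableSet_Ioi] at hi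
  have hi' : IntegrableOn (fun r : ℝ => r * F (c * r ^ p)) (Set.Ioi 0) := by
    refine (hi.const_mul |p|⁻¹).congr (ae_of_all _ fun r => ?_)
    dsimp only
    rw [inv_mul_cancel_left₀ hp']
  have he := integral_comp_rpow_Ioi g hp
  rw [setIntegral_congr_fun measurableSet_Ioi hcomp, integral_const_mul, hgint] at he
  rw [lintegral_radial (f := fun r => F (c * r ^ p)) (fun r hr => hF _ (by positivity)) hi']
  congr 1
  rw [div_mul_eq_mul_div, div_mul_eq_mul_div, eq_div_iff hp', mul_assoc (2 * Real.pi),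
    mul_assoc (2 * Real.pi), ← he]
  ring

namespace Params

variable (S : Params)

lemma α_pos : 0 < S.α := two_pos.trans S.two_lt_α

lemma δ_pos : 0 < S.δ := div_pos two_pos S.α_pos

lemma δ_lt_one : S.δ < 1 := (div_lt_one S.α_pos).2 S.two_lt_α

lemma nodeLaplace_eq_ofReal {c : ℝ} (hc : 0 < c) {x : Plane} (hx : x ≠ 0) :
    S.nodeLaplace c x = ENNReal.ofReal (1 / (1 + c * ‖x‖ ^ (-S.α))) := by
  have hx' : 0 < ‖x‖ := norm_pos_iff.2 hx
  rw [nodeLaplace, ← ofReal_norm, ENNReal.ofReal_rpow_of_pos hx', ← ENNReal.ofReal_mul hc.le,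
    ← ENNReal.ofReal_one, ← ENNReal.ofReal_add zero_le_one (by positivity),
    ← ENNReal.ofReal_inv_of_pos (by positivity), one_div]

/-! ## The integral over the plane in the Laplace transforms of Poisson interference -/

/-- Binomial expansion of (1 + w)^n - 1. The exponent of the denominator, equal to n, is kept as a
sum to match `betaFn`. -/
lemma rpow_mul_one_sub_pow_eq_sum {δ w : ℝ} (hw : 0 < w) (n : ℕ) :
    w ^ (-δ - 1) * (1 - (1 / (1 + w)) ^ n) =
      ∑ p ∈ Finset.Icc 1 n, (n.choose p : ℝ) *
        (w ^ ((p : ℝ) - δ - 1) / (1 + w) ^ ((p : ℝ) - δ + ((n : ℝ) - p + δ))) := by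
  have h1 : (0 : ℝ) < (1 + w) ^ n := by positivity
  have h2 : (1 + w) ^ n = 1 + ∑ p ∈ Finset.Icc 1 n, (n.choose p : ℝ) * w ^ p := by
    rw [add_comm 1 w, add_pow, Finset.range_eq_Ico, Finset.sum_eq_sum_Ico_succ_bot (by omega)]
    simp only [pow_zero, one_pow, mul_one, Nat.choose_zero_right, Nat.cast_one, zero_add]
    congr 1
    refine Finset.sum_congr (by ext; simp) fun p _ => mul_comm _ _
  have h3 : 1 - (1 / (1 + w)) ^ n =
      (∑ p ∈ Finset.Icc 1 n, (n.choose p : ℝ) * w ^ p) / (1 + w) ^ n := by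
    rw [eq_div_iff h1.ne', div_pow, one_pow, sub_mul, one_mul, div_mul_cancel₀ _ h1.ne', h2]
    ring
  rw [h3, Finset.sum_div, Finset.mul_sum]
  refine Finset.sum_congr rfl fun p _ => ?_
  rw [show (p : ℝ) - δ + ((n : ℝ) - p + δ) = n by ring, Real.rpow_natCast,
    show (p : ℝ) - δ - 1 = -δ - 1 + p by ring, Real.rpow_add hw, Real.rpow_natCast]
  ring

/-- Both Beta arguments are positive: p ≥ 1 > δ for the first, p ≤ n and δ > 0 for the second. -/
lemma integrableOn_and_integral_rpow_mul_one_sub_pow {δ : ℝ} (hδ : 0 < δ) (hδ' : δ < 1) (n : ℕ) :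
    IntegrableOn (fun w : ℝ => w ^ (-δ - 1) * (1 - (1 / (1 + w)) ^ n)) (Set.Ioi 0) ∧
    ∫ w in Set.Ioi (0 : ℝ), w ^ (-δ - 1) * (1 - (1 / (1 + w)) ^ n) =
      ∑ p ∈ Finset.Icc 1 n, (n.choose p : ℝ) * betaFn (p - δ) (n - p + δ) := by
  have hi : ∀ p ∈ Finset.Icc 1 n, IntegrableOn (fun w : ℝ => (n.choose p : ℝ) *
      (w ^ ((p : ℝ) - δ - 1) / (1 + w) ^ ((p : ℝ) - δ + ((n : ℝ) - p + δ)))) (Set.Ioi 0) := by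
    intro p hp
    obtain ⟨h1, h2⟩ := Finset.mem_Icc.1 hp
    have h1' : (1 : ℝ) ≤ p := by exact_mod_cast h1
    have h2' : (p : ℝ) ≤ n := by exact_mod_cast h2
    exact (integrableOn_beta (by linarith) (by linarith)).const_mul _
  have heq : Set.EqOn (fun w : ℝ => w ^ (-δ - 1) * (1 - (1 / (1 + w)) ^ n)) (fun w =>
      ∑ p ∈ Finset.Icc 1 n, (n.choose p : ℝ) *
        (w ^ ((p : ℝ) - δ - 1) / (1 + w) ^ ((p : ℝ) - δ + ((n : ℝ) - p + δ)))) (Set.Ioi 0) :=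
    fun w hw => rpow_mul_one_sub_pow_eq_sum hw n
  refine ⟨?_, ?_⟩
  · rw [integrableOn_congr_fun heq measurableSet_Ioi]
    exact integrable_finsetSum _ hi
  · rw [setIntegral_congr_fun measurableSet_Ioi heq, integral_finsetSum _ hi]
    refine Finset.sum_congr rfl fun p _ => ?_
    rw [integral_const_mul, betaFn]

lemma lintegral_one_sub_nodeLaplace_pow {c : ℝ} (hc : 0 < c) (n : ℕ) :
    ∫⁻ x, (1 - S.nodeLaplace c x ^ n) = ENNReal.ofReal (Real.pi * c ^ S.δ * S.δ *
      ∑ p ∈ Finset.Icc 1 n, (n.choose p : ℝ) * betaFn (p - S.δ) (n - p + S.δ)) := by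
  obtain ⟨hi, he⟩ := integrableOn_and_integral_rpow_mul_one_sub_pow S.δ_pos S.δ_lt_one n
  have hδ : 2 / -S.α = -S.δ := by rw [δ, div_neg]
  have h := lintegral_comp_norm_rpow (F := fun w => 1 - (1 / (1 + w)) ^ n) (p := -S.α)
    (fun w hw => sub_nonneg.2 (pow_le_one₀ (by positivity)
      ((div_le_one (by positivity)).2 (by linarith)))) hc (neg_ne_zero.2 S.α_pos.ne')
    (by rwa [hδ])
  rw [hδ, he, neg_neg, abs_neg, abs_of_pos S.α_pos] at h
  calc ∫⁻ x, (1 - S.nodeLaplace c x ^ n)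
      = ∫⁻ x : Plane, ENNReal.ofReal (1 - (1 / (1 + c * ‖x‖ ^ (-S.α))) ^ n) := by
        refine lintegral_congr_ae ?_
        -- The origin is excluded because there ‖x‖^(-α) is 0 in the reals but ∞ in `ℝ≥0∞`.
        filter_upwards [Measure.ae_ne volume (0 : Plane)] with x hx
        rw [S.nodeLaplace_eq_ofReal hc hx, ENNReal.ofReal_sub _ (by positivity),
          ENNReal.ofReal_one, ENNReal.ofReal_pow (by positivity)]
    _ = _ := by
        rw [h]
        congr 1
        rw [δ]
        ring

lemma lintegral_one_sub_nodeLaplace {c : ℝ} (hc : 0 < c) :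
    ∫⁻ x, (1 - S.nodeLaplace c x) = ENNReal.ofReal (Real.pi * c ^ S.δ * S.δ *
      (Real.Gamma S.δ * Real.Gamma (1 - S.δ))) := by
  have h := S.lintegral_one_sub_nodeLaplace_pow hc 1
  have hb := betaFn_eq (x := 1 - S.δ) (y := S.δ) (by linarith [S.δ_lt_one]) S.δ_pos
  rw [sub_add_cancel, Real.Gamma_one, div_one] at hb
  simpa [hb, mul_comm (Real.Gamma S.δ)] using h

/-! ## The Laplace transform of a node in the disc -/

lemma uniformDisc_lintegral {r : ℝ} (hr : 0 < r) (f : Plane → ℝ≥0∞) :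
    ∫⁻ x, f x ∂(uniformDisc r) = ENNReal.ofReal (1 / (Real.pi * r ^ 2)) *
      ∫⁻ x, (Metric.closedBall (0 : Plane) r).indicator f x := by
  rw [uniformDisc, ProbabilityTheory.cond, lintegral_smul_measure,
    EuclideanSpace.volume_closedBall_fin_two, lintegral_indicator measurableSet_closedBall,
    ← ENNReal.ofReal_pow hr.le, ← ENNReal.ofReal_mul (by positivity), smul_eq_mul,
    ← ENNReal.ofReal_inv_of_pos (by positivity), one_div, mul_comm Real.pi]

/-- For c = b + 1 the factor (1 - t)^(c-b-1) in Euler's integral is 1 and the Gamma quotient is b.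
-/
lemma gaussHyp_one {b z : ℝ} (hb : 0 < b) :
    gaussHyp 1 b (b + 1) (-z) = b * ∫ t in (0 : ℝ)..1, t ^ (b - 1) * (1 + z * t)⁻¹ := by
  rw [gaussHyp, Real.Gamma_add_one hb.ne', add_sub_cancel_left, Real.Gamma_one, mul_one,
    mul_div_cancel_right₀ _ (Real.Gamma_pos_of_pos hb).ne']
  congr 1
  refine intervalIntegral.integral_congr fun t _ => ?_
  simp [Real.rpow_neg_one]

lemma intervalIntegrable_rpow_mul_inv {b z : ℝ} (hb : 0 < b) (hz : 0 < z) :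
    IntervalIntegrable (fun t : ℝ => t ^ (b - 1) * (1 + z * t)⁻¹) volume 0 1 := by
  refine (intervalIntegral.intervalIntegrable_rpow' (by linarith)).mul_continuousOn ?_
  refine ContinuousOn.inv₀ (by fun_prop) fun t ht => ?_
  rw [Set.uIcc_of_le zero_le_one] at ht
  have := mul_nonneg hz.le ht.1
  positivity

/-- With t = (‖x‖/a)^α and z = a^α/c, the transform of one node becomes zt/(1 + zt), and the disc
becomes t ≤ 1. -/
lemma discLaplace_zero {c : ℝ} (hc : 0 < c) :
    S.discLaplace c 0 = ENNReal.ofReal (S.δ * (S.a ^ S.α / c) *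
      ∫ t in (0 : ℝ)..1, t ^ S.δ * (1 + S.a ^ S.α / c * t)⁻¹) := by
  set z := S.a ^ S.α / c with hz
  have hδ := S.δ_pos
  have haα : 0 < S.a ^ S.α := Real.rpow_pos_of_pos S.a_pos _
  have hz0 : 0 < z := div_pos haα hc
  set F : ℝ → ℝ := (Set.Iic 1).indicator fun t => z * t * (1 + z * t)⁻¹ with hF
  have hFnn : ∀ w, 0 ≤ w → 0 ≤ F w := fun w hw => by
    rw [hF, Set.indicator_apply]
    split_ifs <;> positivity
  have hFeq : Set.EqOn (fun w => w ^ (2 / S.α - 1) * F w)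
      ((Set.Iic 1).indicator fun w => z * (w ^ S.δ * (1 + z * w)⁻¹)) (Set.Ioi 0) := by
    intro w hw
    by_cases h : w ∈ Set.Iic (1 : ℝ)
    · simp only [hF, Set.indicator_of_mem h]
      rw [show S.δ = 2 / S.α - 1 + 1 by rw [δ]; ring, Real.rpow_add_one (ne_of_gt hw)]
      ring
    · simp only [hF, Set.indicator_of_notMem h, mul_zero]
  have hI : IntervalIntegrable (fun t : ℝ => z * (t ^ S.δ * (1 + z * t)⁻¹)) volume 0 1 := by
    have := intervalIntegrable_rpow_mul_inv (b := S.δ + 1) (by linarith) hz0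
    rw [add_sub_cancel_right] at this
    exact this.const_mul z
  have hint : IntegrableOn (fun w => w ^ (2 / S.α - 1) * F w) (Set.Ioi 0) := by
    rw [integrableOn_congr_fun hFeq measurableSet_Ioi, IntegrableOn,
      integrable_indicator_iff measurableSet_Iic, IntegrableOn, Measure.restrict_restrict
      measurableSet_Iic, Set.inter_comm, Set.Ioi_inter_Iic]
    exact hI.1
  have hval : ∫ w in Set.Ioi (0 : ℝ), w ^ (2 / S.α - 1) * F w =
      z * ∫ t in (0 : ℝ)..1, t ^ S.δ * (1 + z * t)⁻¹ := by
    rw [setIntegral_congr_fun measurableSet_Ioi hFeq, setIntegral_indicator measurableSet_Iic,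
      Set.Ioi_inter_Iic, ← intervalIntegral.integral_const_mul,
      intervalIntegral.integral_of_le zero_le_one]
  have h := lintegral_comp_norm_rpow hFnn (inv_pos.2 haα) S.α_pos.ne' hint
  have hcong : ∫⁻ x, (Metric.closedBall (0 : Plane) S.a).indicator (S.nodeLaplace c) x =
      ∫⁻ x : Plane, ENNReal.ofReal (F ((S.a ^ S.α)⁻¹ * ‖x‖ ^ S.α)) := by
    refine lintegral_congr_ae ?_
    filter_upwards [Measure.ae_ne volume (0 : Plane)] with x hx
    have hx' : 0 < ‖x‖ := norm_pos_iff.2 hx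
    have hxα : 0 < ‖x‖ ^ S.α := Real.rpow_pos_of_pos hx' _
    have hiff : (S.a ^ S.α)⁻¹ * ‖x‖ ^ S.α ∈ Set.Iic (1 : ℝ) ↔
        x ∈ Metric.closedBall (0 : Plane) S.a := by
      rw [Set.mem_Iic, mem_closedBall_zero_iff, inv_mul_le_one₀ haα,
        Real.rpow_le_rpow_iff hx'.le S.a_pos.le S.α_pos]
    by_cases hm : x ∈ Metric.closedBall (0 : Plane) S.a
    · rw [Set.indicator_of_mem hm, hF, Set.indicator_of_mem (hiff.2 hm),
        S.nodeLaplace_eq_ofReal hc hx, Real.rpow_neg hx'.le]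
      congr 1
      rw [hz]
      field_simp
      rw [add_comm]
    · rw [Set.indicator_of_notMem hm, hF, Set.indicator_of_notMem (fun h => hm (hiff.1 h)),
        ENNReal.ofReal_zero]
  rw [discLaplace]
  simp_rw [zero_add]
  rw [uniformDisc_lintegral S.a_pos, hcong, h, hval, abs_of_pos S.α_pos,
    ← ENNReal.ofReal_mul (by have := S.a_pos; positivity)]
  congr 1
  have h2 : ((S.a ^ S.α)⁻¹) ^ (-(2 / S.α)) = S.a ^ 2 := by
    rw [Real.inv_rpow haα.le, Real.rpow_neg haα.le, inv_inv, ← Real.rpow_mul S.a_pos.le,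
      mul_div_cancel₀ _ S.α_pos.ne', Real.rpow_two]
  have := S.a_pos.ne'
  have := Real.pi_pos.ne'
  rw [h2, δ]
  field_simp

/-- Integrate t^(δ-1) = (t^(δ-1) + z t^δ)/(1 + zt) over (0, 1). This links the hypergeometric
expression of the fixed model to that of the random one. -/
lemma integral_rpow_div_eq_one_sub {δ z : ℝ} (hδ : 0 < δ) (hz : 0 < z) :
    δ * z * ∫ t in (0 : ℝ)..1, t ^ δ * (1 + z * t)⁻¹ =
      1 - δ * ∫ t in (0 : ℝ)..1, t ^ (δ - 1) * (1 + z * t)⁻¹ := by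
  have h1 := intervalIntegrable_rpow_mul_inv hδ hz
  have h2 := intervalIntegrable_rpow_mul_inv (b := δ + 1) (by linarith) hz
  rw [add_sub_cancel_right] at h2
  have h3 : ∫ t in (0 : ℝ)..1, t ^ (δ - 1) = 1 / δ := by
    rw [integral_rpow (Or.inl (by linarith))]
    simp [hδ.ne']
  have h4 : ∫ t in (0 : ℝ)..1, t ^ (δ - 1) =
      (∫ t in (0 : ℝ)..1, t ^ (δ - 1) * (1 + z * t)⁻¹) +
        z * ∫ t in (0 : ℝ)..1, t ^ δ * (1 + z * t)⁻¹ := by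
    rw [← intervalIntegral.integral_const_mul, ← intervalIntegral.integral_add h1 (h2.const_mul z),
      intervalIntegral.integral_of_le zero_le_one, intervalIntegral.integral_of_le zero_le_one]
    refine setIntegral_congr_fun measurableSet_Ioc fun t ht => ?_
    have ht' : 0 < t := ht.1
    rw [show t ^ δ = t ^ (δ - 1) * t by rw [← Real.rpow_add_one ht'.ne', sub_add_cancel]]
    have : 1 + z * t ≠ 0 := by positivity
    field_simp
  rw [h3] at h4
  have h5 : δ * (1 / δ) = 1 := mul_one_div_cancel hδ.ne'
  rw [h4] at h5
  linarith

end Params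

/-! ### Comparing a cluster with a single node by averaging over the disc -/

lemma isProbabilityMeasure_uniformDisc {r : ℝ} (hr : 0 < r) :
    IsProbabilityMeasure (uniformDisc r) := by
  refine cond_isProbabilityMeasure_of_finite ?_ measure_closedBall_lt_top.ne
  rw [EuclideanSpace.volume_closedBall_fin_two]
  simp [hr, Real.pi_pos]

/-- Jensen's inequality for powers. -/
lemma lintegral_pow_le {E : Type*} [MeasurableSpace E] {μ : Measure E} [IsProbabilityMeasure μ]
    {f : E → ℝ≥0∞} (hf : Measurable f) (n : ℕ) : (∫⁻ x, f x ∂μ) ^ n ≤ ∫⁻ x, f x ^ n ∂μ := by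
  rcases Nat.eq_zero_or_pos n with rfl | hn
  · simp
  have hn' : (1 : ℝ) ≤ n := by exact_mod_cast hn
  -- On a probability space the L¹ norm is at most the Lⁿ norm.
  have h := eLpNorm'_le_eLpNorm'_of_exponent_le one_pos hn' μ hf.aestronglyMeasurable
  simp only [eLpNorm', enorm_eq_self, ENNReal.rpow_one, div_one, ENNReal.rpow_natCast] at h
  calc (∫⁻ x, f x ∂μ) ^ n ≤ ((∫⁻ x, f x ^ n ∂μ) ^ (1 / (n : ℝ))) ^ n := by gcongr
    _ = _ := by
      rw [← ENNReal.rpow_natCast, ← ENNReal.rpow_mul, one_div_mul_cancel (by positivity),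
        ENNReal.rpow_one]

lemma betaFn_nonneg (x y : ℝ) : 0 ≤ betaFn x y :=
  setIntegral_nonneg measurableSet_Ioi fun t ht => by
    have : (0 : ℝ) < t := ht
    positivity

namespace Params

variable (S : Params)

/-- Tonelli and translation invariance: spreading by a probability measure preserves the total
integral. This removes the cluster displacements from both bounds. -/
lemma lintegral_lintegral_disc {f : Plane → ℝ≥0∞} (hf : Measurable f) :
    ∫⁻ x, ∫⁻ y, f (x + y) ∂(uniformDisc S.a) = ∫⁻ x, f x := by
  have := isProbabilityMeasure_uniformDisc S.a_pos
  rw [lintegral_lintegral_swap (Measurable.aemeasurable (by unfold Function.uncurry; fun_prop))]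
  simp_rw [lintegral_add_right_eq_self]
  simp

lemma lintegral_one_sub {μ : Measure Plane} [IsProbabilityMeasure μ] {f : Plane → ℝ≥0∞}
    (hf : Measurable f) (h1 : ∀ x, f x ≤ 1) : ∫⁻ x, (1 - f x) ∂μ = 1 - ∫⁻ x, f x ∂μ := by
  rw [lintegral_sub hf _ (ae_of_all _ h1)]
  · simp
  · refine ne_top_of_le_ne_top ENNReal.one_ne_top ((lintegral_mono h1).trans ?_)
    simp

lemma discLaplace_le_one (c : ℝ) (x : Plane) : S.discLaplace c x ≤ 1 := by
  have := isProbabilityMeasure_uniformDisc S.a_pos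
  exact (lintegral_mono fun y => S.nodeLaplace_le_one c _).trans (by simp)

/-- Jensen inside each disc, then the averaging identity; this is the only loss in the upper bound
of the fixed model. -/
lemma lintegral_one_sub_nodeLaplace_pow_le (c : ℝ) (n : ℕ) :
    ∫⁻ x, (1 - S.nodeLaplace c x ^ n) ≤ ∫⁻ x, (1 - S.discLaplace c x ^ n) := by
  have := isProbabilityMeasure_uniformDisc S.a_pos
  rw [← S.lintegral_lintegral_disc (f := fun x => 1 - S.nodeLaplace c x ^ n) (by fun_prop)]
  refine lintegral_mono fun x => ?_
  have hm : Measurable fun y => S.nodeLaplace c (x + y) := by fun_prop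
  rw [lintegral_one_sub (hm.pow_const n) fun y => pow_le_one₀ zero_le (S.nodeLaplace_le_one c _)]
  exact tsub_le_tsub_left (lintegral_pow_le hm n) 1

lemma lintegral_one_sub_discLaplace (c : ℝ) :
    ∫⁻ x, (1 - S.discLaplace c x) = ∫⁻ x, (1 - S.nodeLaplace c x) := by
  have := isProbabilityMeasure_uniformDisc S.a_pos
  rw [← S.lintegral_lintegral_disc (f := fun x => 1 - S.nodeLaplace c x) (by fun_prop)]
  refine lintegral_congr fun x => ?_
  rw [lintegral_one_sub (by fun_prop) fun y => S.nodeLaplace_le_one c _]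
  rfl

@[fun_prop]
lemma measurable_discLaplace_zero : Measurable fun c => S.discLaplace c 0 := by
  have := isProbabilityMeasure_uniformDisc S.a_pos
  have h : Measurable fun q : ℝ × Plane => S.nodeLaplace q.1 (0 + q.2) := by
    unfold nodeLaplace; fun_prop
  exact h.lintegral_prod_right'

/-! ## The closed forms -/

section ClosedForms

variable {s : ℝ}

lemma scale_pos {p : ℝ} (hs : 0 < s) (hp : 0 < p) : 0 < s * p * S.η :=
  mul_pos (mul_pos hs hp) S.η_pos

lemma lapIntraFixed_eq (hs : 0 < s) (n : ℕ) :
    S.lapIntraFixed n s = (S.discLaplace (s * S.Px * S.η) 0).toReal ^ (n - 1) := by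
  have hc := S.scale_pos hs S.Px_pos
  have hz : 0 < S.a ^ S.α / (s * S.Px * S.η) := div_pos (Real.rpow_pos_of_pos S.a_pos _) hc
  have hδ := S.δ_pos
  have hnn : 0 ≤ ∫ t in (0 : ℝ)..1, t ^ S.δ * (1 + S.a ^ S.α / (s * S.Px * S.η) * t)⁻¹ :=
    intervalIntegral.integral_nonneg zero_le_one fun t ht => by have := ht.1; positivity
  have h1 : S.δ + 1 ≠ 0 := by positivity
  rw [lapIntraFixed, show S.δ + 2 = (S.δ + 1) + 1 by ring, gaussHyp_one (by linarith),
    S.discLaplace_zero hc, ENNReal.toReal_ofReal (by positivity), add_sub_cancel_right]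
  congr 1
  field_simp

lemma lapIntraPoisson_eq (hs : 0 < s) (nbar : ℝ) :
    S.lapIntraPoisson nbar s =
      Real.exp (-((nbar - 1) * (1 - (S.discLaplace (s * S.Px * S.η) 0).toReal))) := by
  have hc := S.scale_pos hs S.Px_pos
  have hz : 0 < S.a ^ S.α / (s * S.Px * S.η) := div_pos (Real.rpow_pos_of_pos S.a_pos _) hc
  have hδ := S.δ_pos
  have hnn : 0 ≤ ∫ t in (0 : ℝ)..1, t ^ S.δ * (1 + S.a ^ S.α / (s * S.Px * S.η) * t)⁻¹ :=
    intervalIntegral.integral_nonneg zero_le_one fun t ht => by have := ht.1; positivity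
  rw [lapIntraPoisson, gaussHyp_one hδ, S.discLaplace_zero hc,
    ENNReal.toReal_ofReal (by positivity), integral_rpow_div_eq_one_sub hδ hz, sub_sub_cancel]

lemma expNeg_mul_ofReal (d : ℝ≥0) {A : ℝ} (hA : 0 ≤ A) :
    expNeg (d * ENNReal.ofReal A) = ENNReal.ofReal (Real.exp (-(d * A))) := by
  rw [← ENNReal.ofReal_coe_nnreal, ← ENNReal.ofReal_mul d.coe_nonneg,
    expNeg_ofReal (mul_nonneg d.coe_nonneg hA)]

lemma Gamma_mul_Gamma_pos : 0 < Real.Gamma S.δ * Real.Gamma (1 - S.δ) :=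
  mul_pos (Real.Gamma_pos_of_pos S.δ_pos) (Real.Gamma_pos_of_pos (sub_pos.2 S.δ_lt_one))

lemma expNeg_coexistence (hs : 0 < s) :
    expNeg (S.densCo * ∫⁻ x, (1 - S.nodeLaplace (s * S.Pz * S.η) x)) =
      ENNReal.ofReal (S.lapCo s) := by
  have hc := S.scale_pos hs S.Pz_pos
  have hδ := S.δ_pos
  have hG := S.Gamma_mul_Gamma_pos
  rw [S.lintegral_one_sub_nodeLaplace hc, expNeg_mul_ofReal _ (by positivity), lapCo, add_comm 1,
    Real.Gamma_add_one hδ.ne']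
  ring_nf

lemma expNeg_inter_fixed_le (hs : 0 < s) (n : ℕ) :
    expNeg (S.densG * ∫⁻ x, (1 - ∫⁻ k, S.discLaplace (s * S.Px * S.η) x ^ k ∂(Measure.dirac n))) ≤
      ENNReal.ofReal (S.lapInterUp n s) := by
  have hc := S.scale_pos hs S.Px_pos
  have hδ := S.δ_pos
  have hsum : 0 ≤ ∑ p ∈ Finset.Icc 1 n, (n.choose p : ℝ) * betaFn (p - S.δ) (n - p + S.δ) :=
    Finset.sum_nonneg fun p _ => mul_nonneg (Nat.cast_nonneg _) (betaFn_nonneg _ _)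
  simp_rw [lintegral_dirac]
  refine (antitone_expNeg (mul_le_mul_right
    (S.lintegral_one_sub_nodeLaplace_pow_le (s * S.Px * S.η) n) _)).trans_eq ?_
  rw [S.lintegral_one_sub_nodeLaplace_pow hc, expNeg_mul_ofReal _ (by positivity), lapInterUp]
  congr 3
  ring

/-- The Poisson generating function gives 1 - exp(-n̄(1 - V)) ≤ n̄(1 - V), whose integral is known
exactly. Euler's reflection formula supplies the sine and the second factor π. -/
lemma le_expNeg_inter_poisson (hs : 0 < s) (nbar : ℝ≥0) :
    ENNReal.ofReal (S.lapInterLow nbar s) ≤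
      expNeg (S.densG * ∫⁻ x, (1 - ∫⁻ k, S.discLaplace (s * S.Px * S.η) x ^ k
        ∂(poissonMeasure nbar))) := by
  have hc := S.scale_pos hs S.Px_pos
  have hδ := S.δ_pos
  have hG := S.Gamma_mul_Gamma_pos
  simp_rw [lintegral_pow_poissonMeasure _ (S.discLaplace_le_one _ _)]
  have hle : ∫⁻ x, (1 - expNeg (nbar * (1 - S.discLaplace (s * S.Px * S.η) x))) ≤
      nbar * ∫⁻ x, (1 - S.nodeLaplace (s * S.Px * S.η) x) := by
    rw [← S.lintegral_one_sub_discLaplace, ← lintegral_const_mul' _ _ ENNReal.coe_ne_top]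
    exact lintegral_mono fun x => one_sub_expNeg_le _
  refine le_trans (le_of_eq ?_) (antitone_expNeg (mul_le_mul_right hle _))
  rw [S.lintegral_one_sub_nodeLaplace hc, ← mul_assoc, ← ENNReal.coe_mul,
    expNeg_mul_ofReal _ (by positivity), lapInterLow, Real.Gamma_mul_Gamma_one_sub, NNReal.coe_mul]
  ring_nf

end ClosedForms

/-! ## Averaging over the position of the typical node -/

/-- The distance of the typical node from the origin has density 2r/a² on (0, a). `K` is cut off to
this interval because its sign is known for r > 0 only. -/
lemma lintegral_uniformDisc_radial {K : ℝ → ℝ} (hK : ∀ r, 0 < r → 0 ≤ K r)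
    (hint : IntervalIntegrable (fun r => K r * r) volume 0 S.a) :
    ∫⁻ x, ENNReal.ofReal (K ‖x‖) ∂(uniformDisc S.a) =
      ENNReal.ofReal (2 / S.a ^ 2 * ∫ r in (0 : ℝ)..S.a, K r * r) := by
  have ha := S.a_pos
  have hnn : ∀ r, 0 ≤ r → 0 ≤ (Set.Ioc 0 S.a).indicator K r := fun r _ => by
    rw [Set.indicator_apply]
    split_ifs with h
    exacts [hK r h.1, le_rfl]
  have heq : (fun r => r * (Set.Ioc 0 S.a).indicator K r) =
      (Set.Ioc 0 S.a).indicator fun r => K r * r := by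
    ext r
    simp only [Set.indicator_apply]
    split_ifs <;> ring
  have hI : IntegrableOn (fun r => r * (Set.Ioc 0 S.a).indicator K r) (Set.Ioi 0) := by
    rw [heq]
    exact ((integrable_indicator_iff measurableSet_Ioc).2 hint.1).integrableOn
  have hcong : ∫⁻ x, (Metric.closedBall (0 : Plane) S.a).indicator
      (fun x => ENNReal.ofReal (K ‖x‖)) x =
      ∫⁻ x : Plane, ENNReal.ofReal ((Set.Ioc 0 S.a).indicator K ‖x‖) := by
    refine lintegral_congr_ae ?_
    filter_upwards [Measure.ae_ne volume (0 : Plane)] with x hx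
    have hx' : 0 < ‖x‖ := norm_pos_iff.2 hx
    by_cases h : ‖x‖ ≤ S.a <;> simp [h, hx']
  rw [uniformDisc_lintegral ha, hcong, lintegral_radial hnn hI, heq,
    setIntegral_indicator measurableSet_Ioc, Set.inter_eq_right.2 Set.Ioc_subset_Ioi_self,
    ← intervalIntegral.integral_of_le ha.le, ← ENNReal.ofReal_mul (by positivity)]
  congr 1
  have := Real.pi_pos.ne'
  field_simp

/-- Boundedness gives integrability once measurability is known. `M` supplies the latter: it
replaces the hypergeometric factor of `K` by an expression in `discLaplace`, which is measurable by
Tonelli. -/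
lemma intervalIntegrable_mul_self {K M : ℝ → ℝ} (hM : Measurable M) (hKM : ∀ r, 0 < r → K r = M r)
    (hK : ∀ r, 0 < r → K r ∈ Set.Icc (0 : ℝ) 1) :
    IntervalIntegrable (fun r => K r * r) volume 0 S.a := by
  have ha := S.a_pos
  rw [intervalIntegrable_iff_integrableOn_Ioc_of_le ha.le]
  have h : IntegrableOn (fun r => M r * r) (Set.Ioc 0 S.a) := by
    refine Measure.integrableOn_of_bounded (M := S.a) (by simp)
      (by fun_prop) ?_
    filter_upwards [ae_restrict_mem measurableSet_Ioc] with r hr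
    obtain ⟨h0, h1⟩ := hK r hr.1
    rw [hKM r hr.1] at h0 h1
    rw [Real.norm_of_nonneg (mul_nonneg h0 hr.1.le)]
    nlinarith [hr.1, hr.2]
  exact h.congr_fun (fun r hr => by rw [hKM r hr.1]) measurableSet_Ioc

/-! ### Bounds on the factors and convergence of the integrals -/

lemma ρ_pos {γ r : ℝ} (hγ : 0 < γ) (hr : 0 < r) : 0 < S.ρ γ r :=
  div_pos (mul_pos (Real.rpow_pos_of_pos hr _) hγ) (mul_pos S.Px₀_pos S.η_pos)

@[fun_prop]
lemma measurable_ρ (γ : ℝ) : Measurable (S.ρ γ) := by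
  unfold ρ; fun_prop

lemma toReal_discLaplace_mem (c : ℝ) : (S.discLaplace c 0).toReal ∈ Set.Icc (0 : ℝ) 1 :=
  ⟨ENNReal.toReal_nonneg, ENNReal.toReal_le_of_le_ofReal zero_le_one
    (by simpa using S.discLaplace_le_one c 0)⟩

lemma lapIntraFixed_mem {s : ℝ} (hs : 0 < s) (n : ℕ) :
    S.lapIntraFixed n s ∈ Set.Icc (0 : ℝ) 1 := by
  obtain ⟨h0, h1⟩ := S.toReal_discLaplace_mem (s * S.Px * S.η)
  rw [S.lapIntraFixed_eq hs]
  exact ⟨pow_nonneg h0 _, pow_le_one₀ h0 h1⟩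

lemma exp_neg_mem {t : ℝ} (ht : 0 ≤ t) : Real.exp (-t) ∈ Set.Icc (0 : ℝ) 1 :=
  ⟨(Real.exp_pos _).le, Real.exp_le_one_iff.2 (neg_nonpos.2 ht)⟩

lemma mul_mem_Icc {u v : ℝ} (hu : u ∈ Set.Icc (0 : ℝ) 1) (hv : v ∈ Set.Icc (0 : ℝ) 1) :
    u * v ∈ Set.Icc (0 : ℝ) 1 :=
  ⟨mul_nonneg hu.1 hv.1, mul_le_one₀ hu.2 hv.1 hv.2⟩

lemma lapIntraPoisson_mem {s : ℝ} (hs : 0 < s) {nbar : ℝ} (hn : 1 ≤ nbar) :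
    S.lapIntraPoisson nbar s ∈ Set.Icc (0 : ℝ) 1 := by
  obtain ⟨h0, h1⟩ := S.toReal_discLaplace_mem (s * S.Px * S.η)
  rw [S.lapIntraPoisson_eq hs]
  exact exp_neg_mem (mul_nonneg (sub_nonneg.2 hn) (sub_nonneg.2 h1))

lemma lapInterUp_mem {s : ℝ} (hs : 0 < s) (n : ℕ) : S.lapInterUp n s ∈ Set.Icc (0 : ℝ) 1 := by
  have hc := S.scale_pos hs S.Px_pos
  have hδ := S.δ_pos
  have hsum : 0 ≤ ∑ p ∈ Finset.Icc 1 n, (n.choose p : ℝ) * betaFn (p - S.δ) (n - p + S.δ) :=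
    Finset.sum_nonneg fun p _ => mul_nonneg (Nat.cast_nonneg _) (betaFn_nonneg _ _)
  exact exp_neg_mem (by positivity)

lemma lapInterLow_mem {s : ℝ} (hs : 0 < s) {nbar : ℝ} (hn : 1 ≤ nbar) :
    S.lapInterLow nbar s ∈ Set.Icc (0 : ℝ) 1 := by
  have hc := S.scale_pos hs S.Px_pos
  have hδ := S.δ_pos
  have hsin : 0 < Real.sin (Real.pi * S.δ) :=
    Real.sin_pos_of_pos_of_lt_pi (by positivity) (by nlinarith [Real.pi_pos, S.δ_lt_one])
  exact exp_neg_mem (by positivity)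

lemma lapCo_mem {s : ℝ} (hs : 0 < s) : S.lapCo s ∈ Set.Icc (0 : ℝ) 1 := by
  have hc := S.scale_pos hs S.Pz_pos
  have h1 := Real.Gamma_pos_of_pos (show 0 < 1 + S.δ by linarith [S.δ_pos])
  have h2 := Real.Gamma_pos_of_pos (sub_pos.2 S.δ_lt_one)
  exact exp_neg_mem (by positivity)

/-- The product of the Laplace transforms of noise and interference in the upper bound. -/
noncomputable def lapTotUp (n : ℕ) (s : ℝ) : ℝ :=
  Real.exp (-(s * S.σ ^ 2)) * S.lapIntraFixed n s * S.lapInterUp n s * S.lapCo s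

/-- The product of the Laplace transforms of noise and interference in the lower bound. -/
noncomputable def lapTotLow (nbar s : ℝ) : ℝ :=
  Real.exp (-(s * S.σ ^ 2)) * S.lapIntraPoisson nbar s * S.lapInterLow nbar s * S.lapCo s

lemma lapTotUp_mem {s : ℝ} (hs : 0 < s) (n : ℕ) : S.lapTotUp n s ∈ Set.Icc (0 : ℝ) 1 :=
  mul_mem_Icc (mul_mem_Icc (mul_mem_Icc (exp_neg_mem (by positivity)) (S.lapIntraFixed_mem hs n))
    (S.lapInterUp_mem hs n)) (S.lapCo_mem hs)

lemma lapTotLow_mem {s : ℝ} (hs : 0 < s) {nbar : ℝ} (hn : 1 ≤ nbar) :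
    S.lapTotLow nbar s ∈ Set.Icc (0 : ℝ) 1 :=
  mul_mem_Icc (mul_mem_Icc (mul_mem_Icc (exp_neg_mem (by positivity))
    (S.lapIntraPoisson_mem hs hn)) (S.lapInterLow_mem hs hn)) (S.lapCo_mem hs)

lemma intervalIntegrable_integrandUp (n : ℕ) {γ : ℝ} (hγ : 0 < γ) :
    IntervalIntegrable (S.integrandUp n γ) volume 0 S.a := by
  refine S.intervalIntegrable_mul_self (K := fun r => S.lapTotUp n (S.ρ γ r))
    (M := fun r => Real.exp (-(S.ρ γ r * S.σ ^ 2)) *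
      (S.discLaplace (S.ρ γ r * S.Px * S.η) 0).toReal ^ (n - 1) * S.lapInterUp n (S.ρ γ r) *
      S.lapCo (S.ρ γ r)) ?_ (fun r hr => ?_) fun r hr => S.lapTotUp_mem (S.ρ_pos hγ hr) n
  · have h := S.measurable_discLaplace_zero.comp
      (((S.measurable_ρ γ).mul_const S.Px).mul_const S.η)
    have h' : Measurable fun r => (S.discLaplace (S.ρ γ r * S.Px * S.η) 0).toReal :=
      h.ennreal_toReal
    unfold lapInterUp lapCo
    fun_prop
  · simp only [lapTotUp, S.lapIntraFixed_eq (S.ρ_pos hγ hr)]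

lemma intervalIntegrable_integrandLow {nbar : ℝ} (hn : 1 ≤ nbar) {γ : ℝ} (hγ : 0 < γ) :
    IntervalIntegrable (S.integrandLow nbar γ) volume 0 S.a := by
  refine S.intervalIntegrable_mul_self (K := fun r => S.lapTotLow nbar (S.ρ γ r))
    (M := fun r => Real.exp (-(S.ρ γ r * S.σ ^ 2)) * Real.exp (-((nbar - 1) *
      (1 - (S.discLaplace (S.ρ γ r * S.Px * S.η) 0).toReal))) * S.lapInterLow nbar (S.ρ γ r) *
      S.lapCo (S.ρ γ r)) ?_ (fun r hr => ?_) fun r hr => S.lapTotLow_mem (S.ρ_pos hγ hr) hn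
  · have h := S.measurable_discLaplace_zero.comp
      (((S.measurable_ρ γ).mul_const S.Px).mul_const S.η)
    have h' : Measurable fun r => (S.discLaplace (S.ρ γ r * S.Px * S.η) 0).toReal :=
      h.ennreal_toReal
    unfold lapInterLow lapCo
    fun_prop
  · simp only [lapTotLow, S.lapIntraPoisson_eq (S.ρ_pos hγ hr)]

end Params

/-! ### Assembling the two bounds -/

namespace Network

variable {Ω : Type*} [MeasurableSpace Ω] {P : Measure Ω} [IsProbabilityMeasure P]
  {X : Network Ω} {S : Params}

lemma lintegral_expNeg_Itot_fixed_le {n : ℕ} (hX : X.IsMaternFixed P S n) {s : ℝ} (hs : 0 < s) :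
    ∫⁻ ω, expNeg (ENNReal.ofReal s * X.Itot S ω) ∂P ≤ ENNReal.ofReal (S.lapTotUp n s) := by
  have h1 : ∫⁻ k, S.discLaplace (s * S.Px * S.η) 0 ^ k ∂(Measure.dirac (n - 1)) =
      ENNReal.ofReal (S.lapIntraFixed n s) := by
    rw [lintegral_dirac, S.lapIntraFixed_eq hs, ENNReal.ofReal_pow ENNReal.toReal_nonneg,
      ENNReal.ofReal_toReal (ne_top_of_le_ne_top ENNReal.one_ne_top (S.discLaplace_le_one _ _))]
  rw [IsMatern.lintegral_expNeg_Itot hX hs.le, h1, S.expNeg_coexistence hs, Params.lapTotUp,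
    ENNReal.ofReal_mul' (S.lapCo_mem hs).1, ENNReal.ofReal_mul' (S.lapInterUp_mem hs n).1,
    ENNReal.ofReal_mul' (S.lapIntraFixed_mem hs n).1]
  calc _ ≤ ENNReal.ofReal (S.lapIntraFixed n s) * ENNReal.ofReal (S.lapInterUp n s) *
        ENNReal.ofReal (S.lapCo s) * ENNReal.ofReal (Real.exp (-(s * S.σ ^ 2))) := by
        gcongr
        exact S.expNeg_inter_fixed_le hs n
    _ = _ := by ring

lemma le_lintegral_expNeg_Itot_poisson {nbar : ℝ≥0} (hn : 1 ≤ nbar)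
    (hX : X.IsMaternPoisson P S nbar) {s : ℝ} (hs : 0 < s) :
    ENNReal.ofReal (S.lapTotLow nbar s) ≤ ∫⁻ ω, expNeg (ENNReal.ofReal s * X.Itot S ω) ∂P := by
  have hn' : (1 : ℝ) ≤ nbar := by exact_mod_cast hn
  have h1 : ∫⁻ k, S.discLaplace (s * S.Px * S.η) 0 ^ k ∂(poissonMeasure (nbar - 1)) =
      ENNReal.ofReal (S.lapIntraPoisson nbar s) := by
    have hV := S.discLaplace_le_one (s * S.Px * S.η) 0
    have hmem := S.toReal_discLaplace_mem (s * S.Px * S.η)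
    have hsub : 1 - S.discLaplace (s * S.Px * S.η) 0 =
        ENNReal.ofReal (1 - (S.discLaplace (s * S.Px * S.η) 0).toReal) := by
      rw [ENNReal.ofReal_sub _ hmem.1, ENNReal.ofReal_one,
        ENNReal.ofReal_toReal (ne_top_of_le_ne_top ENNReal.one_ne_top hV)]
    -- Subtraction in `ℝ≥0` is truncated; 1 ≤ n̄ makes the mean n̄ - 1 agree with the real
    -- difference.
    rw [lintegral_pow_poissonMeasure _ hV, hsub,
      Params.expNeg_mul_ofReal _ (sub_nonneg.2 hmem.2), S.lapIntraPoisson_eq hs,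
      NNReal.coe_sub hn, NNReal.coe_one]
  rw [IsMatern.lintegral_expNeg_Itot hX hs.le, h1, S.expNeg_coexistence hs, Params.lapTotLow,
    ENNReal.ofReal_mul' (S.lapCo_mem hs).1, ENNReal.ofReal_mul' (S.lapInterLow_mem hs hn').1,
    ENNReal.ofReal_mul' (S.lapIntraPoisson_mem hs hn').1]
  calc _ = ENNReal.ofReal (S.lapIntraPoisson nbar s) * ENNReal.ofReal (S.lapInterLow nbar s) *
        ENNReal.ofReal (S.lapCo s) * ENNReal.ofReal (Real.exp (-(s * S.σ ^ 2))) := by ring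
    _ ≤ _ := by
        gcongr
        exact S.le_expNeg_inter_poisson hs nbar

lemma ae_uniformDisc_norm_pos (r : ℝ) : ∀ᵐ x ∂(uniformDisc r), 0 < ‖x‖ := by
  filter_upwards [cond_absolutelyContinuous.ae_le (Measure.ae_ne volume (0 : Plane))] with x hx
  exact norm_pos_iff.2 hx

theorem coverageProb_fixed_le {n : ℕ} (hX : X.IsMaternFixed P S n) {γ : ℝ} (hγ : 0 < γ) :
    X.coverageProb S P γ ≤ 2 / S.a ^ 2 * ∫ r in (0 : ℝ)..S.a, S.integrandUp n γ r := by
  have ha := S.a_pos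
  have hnn : 0 ≤ ∫ r in (0 : ℝ)..S.a, S.integrandUp n γ r := by
    rw [intervalIntegral.integral_of_le ha.le]
    exact setIntegral_nonneg measurableSet_Ioc fun r hr =>
      mul_nonneg (S.lapTotUp_mem (S.ρ_pos hγ hr.1) n).1 hr.1.le
  refine ENNReal.toReal_le_of_le_ofReal (by positivity) ?_
  rw [IsMatern.measure_coverage hX hγ]
  refine le_trans (lintegral_mono_ae ?_) (S.lintegral_uniformDisc_radial
    (K := fun r => S.lapTotUp n (S.ρ γ r)) (fun r hr => (S.lapTotUp_mem (S.ρ_pos hγ hr) n).1)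
    (S.intervalIntegrable_integrandUp n hγ)).le
  -- The closed forms require ρ > 0, hence a position other than the origin.
  filter_upwards [ae_uniformDisc_norm_pos S.a] with x hx
  exact lintegral_expNeg_Itot_fixed_le hX (S.ρ_pos hγ hx)

theorem le_coverageProb_poisson {nbar : ℝ≥0} (hn : 1 ≤ nbar) (hX : X.IsMaternPoisson P S nbar)
    {γ : ℝ} (hγ : 0 < γ) :
    2 / S.a ^ 2 * ∫ r in (0 : ℝ)..S.a, S.integrandLow nbar γ r ≤ X.coverageProb S P γ := by
  have hn' : (1 : ℝ) ≤ nbar := by exact_mod_cast hn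
  refine (ENNReal.ofReal_le_iff_le_toReal (measure_ne_top _ _)).1 ?_
  rw [IsMatern.measure_coverage hX hγ]
  refine le_trans (S.lintegral_uniformDisc_radial (K := fun r => S.lapTotLow nbar (S.ρ γ r))
    (fun r hr => (S.lapTotLow_mem (S.ρ_pos hγ hr) hn').1)
    (S.intervalIntegrable_integrandLow hn' hγ)).ge (lintegral_mono_ae ?_)
  filter_upwards [ae_uniformDisc_norm_pos S.a] with x hx
  exact le_lintegral_expNeg_Itot_poisson hn hX (S.ρ_pos hγ hx)

end Network

end LoRa

theorem theorem1 {Ω : Type*} [MeasurableSpace Ω] (P : Measure Ω) [IsProbabilityMeasure P]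
    (S : LoRa.Params) (X : LoRa.Network Ω) (γ : ℝ) (hγ : 0 < γ) :
    (∀ n : ℕ, 1 ≤ n → X.IsMaternFixed P S n →
      IntervalIntegrable (S.integrandUp n γ) volume 0 S.a ∧
      X.coverageProb S P γ ≤ 2 / S.a ^ 2 * ∫ r in (0 : ℝ)..S.a, S.integrandUp n γ r) ∧
    (∀ nbar : ℝ≥0, 1 ≤ nbar → X.IsMaternPoisson P S nbar →
      IntervalIntegrable (S.integrandLow nbar γ) volume 0 S.a ∧
      2 / S.a ^ 2 * ∫ r in (0 : ℝ)..S.a, S.integrandLow nbar γ r ≤ X.coverageProb S P γ) :=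
  ⟨fun n _ hX => ⟨S.intervalIntegrable_integrandUp n hγ, LoRa.Network.coverageProb_fixed_le hX hγ⟩,
    fun _ hn hX => ⟨S.intervalIntegrable_integrandLow (by exact_mod_cast hn) hγ,
      LoRa.Network.le_coverageProb_poisson hn hX hγ⟩⟩
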